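/- All spaces are Hausdorff. A space is suborderable if it is homeomorphic to a subspace of a linearly ordered set endowed with its open interval topology. For a space $X$ let $\mathscr{F}_2(X)=\{S\subset X: 1\le |S|\le 2\}$, with the Vietoris topology. A weak selection for $X$ is a map $\sigma:\mathscr{F}_2(X)\to X$ with $\sigma(S)\in S$ for every $S\in\mathscr{F}_2(X)$; it is continuous if it is continuous as a map between these spaces. Write $x<_\sigma y$ if $x\neq y$ and $\sigma(\{x,y\})=x$. The selection topology $\mathscr{T}_\sigma$ is the topology on $X$ which has the sets $\{y: y<_\sigma x\}$ and $\{y: x<_\sigma y\}$, $x\in X$, as a subbase. If the topology $\mathscr{T}$ of $X$ is the smallest topology containing $\bigcup_{\sigma\in\Sigma}\mathscr{T}_\sigma$ for some nonempty collection $\Sigma$ of continuous weak selections for $X$, then $\operatorname{cws}(X)$ denotes the minimal cardinality of such a collection $\Sigma$. **Theorem.** Let $X$ be a suborderable metrizable space with topology $\mathscr{T}$. 1. If $X$ has infinitely many connected components, then $\operatorname{cws}(X)=1$; that is, $\mathscr{T}=\mathscr{T}_\sigma$ for some continuous weak selection $\sigma$ for $X$. 2. More generally, if $X$ has at least $3$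 connected components, then $\operatorname{cws}(X)=1$; that is, $\mathscr{T}=\mathscr{T}_\sigma$ for some continuous weak selection $\sigma$ for $X$. -/

import Mathlib

open Set Topology

universe u v

/-- A space is *suborderable* if it is (homeomorphic to) a subspace of an orderable space, that is
of a linearly ordered set with its open interval topology. -/
def IsSuborderable (X : Type u) [TopologicalSpace X] : Prop :=
  ∃ (Y : Type v) (_ : LinearOrder Y) (_ : TopologicalSpace Y) (_ : OrderTopology Y) (f : X → Y),
    IsEmbedding f

/-- The hyperspace of all subsets of `X` with one or two elements. -/
abbrev TwoSubsets (X : Type u) : Type u :=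
  {S : Set X // 1 ≤ S.encard ∧ S.encard ≤ 2}

/-- The Vietoris topology on the hyperspace of all subsets with one or two elements. -/
instance TwoSubsets.instTopologicalSpace (X : Type u) [TopologicalSpace X] :
    TopologicalSpace (TwoSubsets X) :=
  TopologicalSpace.induced Subtype.val (TopologicalSpace.vietoris X)

/-- The set `{x, y}` as an element of the hyperspace. -/
def TwoSubsets.pair {X : Type u} (x y : X) : TwoSubsets X :=
  ⟨{x, y}, Set.one_le_encard_iff_nonempty.2 ⟨x, Set.mem_insert x {y}⟩, by
    refine (Set.encard_insert_le {y} x).trans ?_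
    rw [Set.encard_singleton, one_add_one_eq_two]⟩

/-- A *weak selection* for a set `X`: it chooses a point of every subset with one or two
elements. -/
structure WeakSelection (X : Type u) where
  toFun : TwoSubsets X → X
  mem : ∀ S : TwoSubsets X, toFun S ∈ S.1

namespace WeakSelection

variable {X : Type u}

/-- The selection relation `x ≤_σ y`. -/
def le (σ : WeakSelection X) (x y : X) : Prop :=
  σ.toFun (TwoSubsets.pair x y) = x

/-- The strict selection relation `x <_σ y`. -/
def lt (σ : WeakSelection X) (x y : X) : Prop :=
  σ.le x y ∧ x ≠ y

/-- The *selection topology*: the open intervals `(←, x)` and `(x, →)` of the selection relation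
form a subbase. -/
@[reducible]
def selectionTopology (σ : WeakSelection X) : TopologicalSpace X :=
  TopologicalSpace.generateFrom
    {S : Set X | ∃ x : X, S = {y | σ.lt y x} ∨ S = {y | σ.lt x y}}

end WeakSelection

/-- The collection `A` of weak selections *generates* the topology of `X`: all its members are
continuous (for the Vietoris topology on the hyperspace), and the topology of `X` is the smallest
topology containing all selection topologies `σ.selectionTopology`, `σ ∈ A`. In Mathlib's order on
`TopologicalSpace X` finer topologies are smaller, so this supremum is written as an infimum. -/
def GeneratesTopology {X : Type u} [t : TopologicalSpace X] (A : Set (WeakSelection X)) : Prop :=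
  (∀ σ ∈ A, Continuous σ.toFun) ∧ t = ⨅ σ ∈ A, σ.selectionTopology

/-- The *cws-number* of `X`: the minimal cardinality of a (nonempty) collection of continuous weak
selections which generates the topology of `X`. It is only meaningful if there is such a
collection; otherwise its value here is `0`. -/
noncomputable def cws (X : Type u) [TopologicalSpace X] : Cardinal.{u} :=
  sInf {κ | ∃ A : Set (WeakSelection X), A.Nonempty ∧ GeneratesTopology A ∧ Cardinal.mk A = κ}

/-! Fix a linear order on the space with order-convex neighbourhood bases, and a bounded compatible
metric that is monotone on order intervals (`exists_isConvexMetric`). Clopen initial segments,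
called cuts, define quasi-components (`Sim`); three connected components give three of these. The
order itself is a continuous selection relation, but its rays may be too coarse: in `{0} ∪ (1, 2]`
they do not isolate `0`. The remedy is to rearrange clopen pieces along tournaments in which
finitely many rays isolate each vertex. These exist on every set with at least three elements
(`exists_isolatingTournament`), but not on two.

A `CutTower` is an increasing sequence of families of cuts with open classes; the classes of level
`n + 1` inside a class of level `n` carry such a tournament. Two points are compared by the
tournament at the first level that separates them, and by the order if no level does, in which case
they share a quasi-component. By induction on the level, isolation makes every class a neighbourhood
for the selection topology (`CutTower.family_mem_nhds`). The classes approximate quasi-components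
ever more closely, and inside a quasi-component the order is used, so all neighbourhoods are
recovered.

The delicate point is continuity at a pair `x < y` in one quasi-component: nearby points may be
separated at a late level and must still be compared as in the order. So at scale `η` a class
contains at most one quasi-component of diameter at least `η`, and the tournament respects the order
across it (`IsArcOn`). This needs no piece or at least three pieces on each side of it. Clopen ends
of big quasi-components are therefore cut off one level in advance; a side that is still nonempty
can then be cut again and again (`IsAdmissible.exists_left`). -/

/-! ### Isolating tournaments. -/

/-- A tournament in which every vertex is isolated from the others by finitely many vertices, and
finitely many vertices dominate all of them. -/
structure IsolatingTournament {I : Type*} (t : I → I → Prop) : Prop where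
  total : ∀ i j, i ≠ j → (t i j ↔ ¬ t j i)
  isolate : ∀ u, ∃ F : Set I, F.Finite ∧ u ∉ F ∧
    ∀ y, y ≠ u → ∃ w ∈ F, w ≠ y ∧ ((t w u ∧ t y w) ∨ (t u w ∧ t w y))
  dominate : ∃ F : Set I, F.Finite ∧ ∀ y, ∃ w ∈ F, w ≠ y ∧ t w y

theorem IsolatingTournament.of_equiv {I J : Type*} (e : I ≃ J) {t : J → J → Prop}
    (h : IsolatingTournament t) : IsolatingTournament fun i j => t (e i) (e j) where
  total i j hij := h.total _ _ fun h' => hij (e.injective h')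
  isolate u := by
    obtain ⟨F, hF, hu, h1⟩ := h.isolate (e u)
    refine ⟨e ⁻¹' F, hF.preimage e.injective.injOn, hu, fun y hy => ?_⟩
    obtain ⟨w, hw, hwy, h2⟩ := h1 (e y) fun h' => hy (e.injective h')
    refine ⟨e.symm w, by simpa using hw, ?_, by simpa using h2⟩
    rintro rfl
    simp at hwy
  dominate := by
    obtain ⟨F, hF, h1⟩ := h.dominate
    refine ⟨e ⁻¹' F, hF.preimage e.injective.injOn, fun y => ?_⟩
    obtain ⟨w, hw, hwy, h2⟩ := h1 (e y)
    refine ⟨e.symm w, by simpa using hw, ?_, by simpa using h2⟩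
    rintro rfl
    simp at hwy

/-- The lexicographic sum of 3-cycles along a well-order. -/
theorem exists_isolatingTournament_prod (J : Type*) [Nonempty J] :
    ∃ t : J × Fin 3 → J × Fin 3 → Prop, IsolatingTournament t := by
  obtain ⟨_, _⟩ := exists_wellFoundedLT J
  refine ⟨fun p q => p.1 < q.1 ∨ (p.1 = q.1 ∧ q.2 = p.2 + 1), ?_, ?_, ?_⟩
  · rintro ⟨i, a⟩ ⟨j, b⟩ hij
    rcases lt_trichotomy i j with h | rfl | h
    · simp [h, h.not_gt, h.ne']
    · have : ∀ a b : Fin 3, a ≠ b → (b = a + 1 ↔ ¬ a = b + 1) := by decide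
      simpa using this a b (by simpa using hij)
    · simp [h, h.not_gt, h.ne']
  · rintro ⟨i, a⟩
    -- The successor in the 3-cycle separates the vertex from all later cycles, the predecessor from
    -- all earlier ones, and one of the two separates it from the other.
    refine ⟨{(i, a + 1), (i, a + 2)}, by simp, ?_, ?_⟩
    · simp
    · rintro ⟨j, b⟩ hij
      rcases lt_trichotomy i j with h | rfl | h
      · exact ⟨(i, a + 1), by simp, by simp [h.ne], Or.inr ⟨by simp, by simp [h]⟩⟩
      · have : ∀ a b : Fin 3, b ≠ a → (a + 1 ≠ b ∧ b = a + 1 + 1) ∨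
          (a + 2 ≠ b ∧ a = a + 2 + 1 ∧ a + 2 = b + 1) := by decide
        rcases this a b (by simpa using hij) with h | h
        · exact ⟨(i, a + 1), by simp, by simpa using h.1, Or.inr ⟨by simp, by simp [h.2]⟩⟩
        · exact ⟨(i, a + 2), by simp, by simpa using h.1,
            Or.inl ⟨Or.inr ⟨rfl, h.2.1⟩, Or.inr ⟨rfl, h.2.2⟩⟩⟩
      · refine ⟨(i, a + 2), by simp, by simp [h.ne'], Or.inl ⟨?_, by simp [h]⟩⟩
        have : ∀ a : Fin 3, a = a + 2 + 1 := by decide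
        exact Or.inr ⟨rfl, this a⟩
  · obtain ⟨m, hm⟩ : ∃ m : J, ∀ j, m ≤ j := by
      obtain ⟨m, -, hm⟩ := (wellFounded_lt (α := J)).has_min univ univ_nonempty
      exact ⟨m, fun j => not_lt.1 (hm j trivial)⟩
    refine ⟨range fun a : Fin 3 => (m, a), finite_range _, ?_⟩
    rintro ⟨j, b⟩
    have : ∀ b : Fin 3, b + 2 ≠ b ∧ b = b + 2 + 1 := by decide
    refine ⟨(m, b + 2), ⟨_, rfl⟩, by simp [(this b).1], ?_⟩
    rcases (hm j).lt_or_eq with h | rfl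
    · exact Or.inl h
    · exact Or.inr ⟨rfl, (this b).2⟩

theorem isolatingTournament_of_finite {I : Type*} [Finite I] {t : I → I → Prop}
    (h : ∀ i j, i ≠ j → (t i j ↔ ¬ t j i))
    (h' : ∀ u y, y ≠ u → ∃ w, w ≠ u ∧ w ≠ y ∧ ((t w u ∧ t y w) ∨ (t u w ∧ t w y)))
    (h'' : ∀ y, ∃ w, w ≠ y ∧ t w y) : IsolatingTournament t where
  total := h
  isolate u := ⟨{u}ᶜ, toFinite _, by simp, fun y hy => by
    obtain ⟨w, h1, h2⟩ := h' u y hy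
    exact ⟨w, by simpa using h1, h2⟩⟩
  dominate := ⟨univ, toFinite _, fun y => by simpa using h'' y⟩

/-- Placing a 3-cycle in front of an isolating tournament gives another one, so three sizes start
the induction: the 3-cycle, the 3-cycle followed by a sink, and the circulant tournament on five
vertices. -/
theorem exists_isolatingTournament_fin (n : ℕ) :
    ∃ t : Fin (n + 3) → Fin (n + 3) → Prop, IsolatingTournament t := by
  induction n using Nat.strong_induction_on with
  | _ n ih =>
  match n with
  | 0 =>
    refine ⟨fun i j => j = i + 1, isolatingTournament_of_finite ?_ ?_ ?_⟩ <;> decide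
  | 1 =>
    refine ⟨fun i j => i ≠ 3 ∧ (j = 3 ∨ (i = 0 ∧ j = 1) ∨ (i = 1 ∧ j = 2) ∨ (i = 2 ∧ j = 0)),
      isolatingTournament_of_finite ?_ ?_ ?_⟩ <;> decide
  | 2 =>
    refine ⟨fun i j => j = i + 1 ∨ j = i + 2, isolatingTournament_of_finite ?_ ?_ ?_⟩ <;> decide
  | n + 3 =>
    obtain ⟨t, ht⟩ := ih n (by omega)
    obtain ⟨D, -, hD⟩ := ht.dominate
    have h3 : ∀ i j : Fin 3, i ≠ j → (j = i + 1 ↔ ¬ i = j + 1) := by decide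
    have key : IsolatingTournament (I := Fin 3 ⊕ Fin (n + 3)) fun p q =>
        Sum.elim (fun i => Sum.elim (fun j => j = i + 1) (fun _ => True) q)
          (fun i => Sum.elim (fun _ => False) (fun j => t i j) q) p := by
      refine isolatingTournament_of_finite ?_ ?_ ?_
      · rintro (i | i) (j | j) hij
        · simpa using h3 i j (by simpa using hij)
        · simp
        · simp
        · simpa using ht.total i j (by simpa using hij)
      · rintro (i | i) (j | j) hij
        · have : ∀ i j : Fin 3, j ≠ i → ∃ w, w ≠ i ∧ w ≠ j ∧
            ((i = w + 1 ∧ w = j + 1) ∨ (w = i + 1 ∧ j = w + 1)) := by decide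
          obtain ⟨w, h1, h2, h3⟩ := this i j (by simpa using hij)
          exact ⟨.inl w, by simpa using h1, by simpa using h2, h3⟩
        · exact ⟨.inl (i + 1), by simp, by simp, Or.inr (by simp)⟩
        -- An old vertex is separated from the new cycle by a vertex preceding it; this is what
        -- domination is for.
        · obtain ⟨w, -, h1, h2⟩ := hD i
          exact ⟨.inr w, by simpa using h1, by simp, Or.inl (by simpa using h2)⟩
        · obtain ⟨F, -, h1, h2⟩ := ht.isolate i
          obtain ⟨w, h3, h4, h5⟩ := h2 j (by simpa using hij)
          refine ⟨.inr w, fun h => ?_, by simpa using h4, by simpa using h5⟩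
          obtain rfl := Sum.inr.inj h
          exact h1 h3
      · rintro (j | j)
        · have : ∀ i : Fin 3, i + 2 ≠ i ∧ i = i + 2 + 1 := by decide
          exact ⟨.inl (j + 2), by simp, by simpa using (this j).2⟩
        · exact ⟨.inl 0, by simp, by simp⟩
    exact ⟨_, key.of_equiv ((finCongr (by omega)).trans finSumFinEquiv.symm)⟩

theorem exists_isolatingTournament {I : Type*} {a b c : I} (hab : a ≠ b) (hac : a ≠ c)
    (hbc : b ≠ c) : ∃ t : I → I → Prop, IsolatingTournament t := by
  classical
  have : Nonempty I := ⟨a⟩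
  rcases finite_or_infinite I with hI | hI
  · have := Fintype.ofFinite I
    have h3 : 3 ≤ Fintype.card I := by
      have h : ({a, b, c} : Finset I).card = 3 := by
        rw [Finset.card_eq_three]
        exact ⟨a, b, c, hab, hac, hbc, rfl⟩
      exact h ▸ Finset.card_le_univ _
    obtain ⟨n, hn⟩ := Nat.exists_eq_add_of_le' h3
    obtain ⟨t, ht⟩ := exists_isolatingTournament_fin n
    exact ⟨_, ht.of_equiv (Fintype.equivFinOfCardEq hn)⟩
  · have : Cardinal.mk I = Cardinal.mk (I × Fin 3) := by
      simp only [Cardinal.mk_prod, Cardinal.lift_uzero, Cardinal.mk_fintype, Fintype.card_fin]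
      simpa using (Cardinal.mul_eq_left (Cardinal.aleph0_le_mk I)
        ((Cardinal.natCast_lt_aleph0 (n := 3)).le.trans (Cardinal.aleph0_le_mk I)) (by simp)).symm
    obtain ⟨e⟩ := Cardinal.eq.1 this
    obtain ⟨t, ht⟩ := exists_isolatingTournament_prod I
    exact ⟨_, ht.of_equiv e⟩

/-- Isolating tournaments on the classes of an equivalence relation in a set. -/
theorem exists_isolatingTournament_setoid {X : Type*} (r : Setoid X) (V : Set X) {a b c : X}
    (ha : a ∈ V) (hb : b ∈ V) (hc : c ∈ V) (hab : ¬ r a b) (hac : ¬ r a c) (hbc : ¬ r b c) :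
    ∃ t : X → X → Prop,
      (∀ u ∈ V, ∀ v ∈ V, ∀ u' ∈ V, ∀ v' ∈ V, r u u' → r v v' → t u v → t u' v') ∧
      (∀ u ∈ V, ∀ v ∈ V, ¬ r u v → (t u v ↔ ¬ t v u)) ∧
      (∀ u ∈ V, ∃ F ⊆ V, F.Finite ∧ (∀ w ∈ F, ¬ r u w) ∧ ∀ y ∈ V, ¬ r u y →
        ∃ w ∈ F, ¬ r y w ∧ ((t w u ∧ t y w) ∨ (t u w ∧ t w y))) ∧
      (∃ F ⊆ V, F.Finite ∧ ∀ y ∈ V, ∃ w ∈ F, ¬ r y w ∧ t w y) := by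
  classical
  let s : Setoid V := r.comap Subtype.val
  have hs : ∀ x y : V, (Quotient.mk s x = Quotient.mk s y) ↔ r x.1 y.1 := fun x y => Quotient.eq
  obtain ⟨t, ht⟩ := exists_isolatingTournament (I := Quotient s) (a := Quotient.mk s ⟨a, ha⟩)
    (b := Quotient.mk s ⟨b, hb⟩) (c := Quotient.mk s ⟨c, hc⟩) (by rwa [Ne, hs]) (by rwa [Ne, hs])
    (by rwa [Ne, hs])
  have hout : ∀ q : Quotient s, Quotient.mk s q.out = q := Quotient.out_eq
  refine ⟨fun u v => ∃ (hu : u ∈ V) (hv : v ∈ V), t (Quotient.mk s ⟨u, hu⟩) (Quotient.mk s ⟨v, hv⟩),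
    ?_, ?_, ?_, ?_⟩
  · rintro u hu v hv u' hu' v' hv' h h' ⟨_, _, h2⟩
    refine ⟨hu', hv', ?_⟩
    rwa [← (hs ⟨u, hu⟩ ⟨u', hu'⟩).2 h, ← (hs ⟨v, hv⟩ ⟨v', hv'⟩).2 h']
  · intro u hu v hv huv
    simpa [hu, hv] using ht.total (Quotient.mk s ⟨u, hu⟩) (Quotient.mk s ⟨v, hv⟩)
      (by rwa [Ne, hs])
  · intro u hu
    obtain ⟨F, hF, h1, h2⟩ := ht.isolate (Quotient.mk s ⟨u, hu⟩)
    refine ⟨(fun q => (Quotient.out q).1) '' F, ?_, hF.image _, ?_, ?_⟩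
    · rintro _ ⟨q, -, rfl⟩; exact (Quotient.out q).2
    · rintro _ ⟨q, hq, rfl⟩ h
      have h' := (hs ⟨u, hu⟩ q.out).2 h
      rw [hout] at h'
      exact h1 (h' ▸ hq)
    · intro y hy huy
      obtain ⟨w, hw, hwy, h3⟩ := h2 (Quotient.mk s ⟨y, hy⟩) fun h =>
        huy (Setoid.symm ((hs ⟨y, hy⟩ ⟨u, hu⟩).1 h))
      refine ⟨_, ⟨w, hw, rfl⟩, fun h => hwy ?_, ?_⟩
      · rw [← hout w]; exact ((hs ⟨y, hy⟩ w.out).2 h).symm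
      · simpa [hu, hy, hout] using h3
  · obtain ⟨F, hF, h2⟩ := ht.dominate
    refine ⟨(fun q => (Quotient.out q).1) '' F, ?_, hF.image _, ?_⟩
    · rintro _ ⟨q, -, rfl⟩; exact (Quotient.out q).2
    · intro y hy
      obtain ⟨w, hw, hwy, h3⟩ := h2 (Quotient.mk s ⟨y, hy⟩)
      refine ⟨_, ⟨w, hw, rfl⟩, fun h => hwy ?_, ?_⟩
      · rw [← hout w]; exact ((hs ⟨y, hy⟩ w.out).2 h).symm
      · simpa [hy, hout] using h3

/-! ### Clopen initial segments and the partitions they define. -/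

/-- The metric is monotone with respect to inclusion of order intervals. -/
class IsConvexMetric (X : Type*) [LinearOrder X] [MetricSpace X] : Prop where
  dist_le_dist : ∀ {a b c d : X}, a ≤ b → b ≤ c → c ≤ d → dist b c ≤ dist a d

/-- A clopen initial segment. -/
def IsCut {X : Type*} [LinearOrder X] [TopologicalSpace X] (A : Set X) : Prop :=
  IsClopen A ∧ IsLowerSet A

/-- Two points are indistinguishable if no member of the family separates them. -/
def Indist {X : Type*} (𝒟 : Set (Set X)) (x y : X) : Prop :=
  ∀ A ∈ 𝒟, (x ∈ A ↔ y ∈ A)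

/-- Two points are in the same quasi-component if no clopen initial segment separates them. -/
abbrev Sim {X : Type*} [LinearOrder X] [TopologicalSpace X] (x y : X) : Prop :=
  Indist {A : Set X | IsCut A} x y

/-- A family of clopen initial segments which partitions the space into open sets. -/
structure IsCutFamily {X : Type*} [LinearOrder X] [TopologicalSpace X] (𝒟 : Set (Set X)) :
    Prop where
  isCut : ∀ A ∈ 𝒟, IsCut A
  eventually : ∀ x, ∀ᶠ y in 𝓝 x, Indist 𝒟 x y

namespace Indist

variable {X : Type*} {𝒟 𝒟' : Set (Set X)} {x y z : X}

theorem refl (𝒟 : Set (Set X)) (x : X) : Indist 𝒟 x x := fun _ _ => Iff.rfl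

theorem symm (h : Indist 𝒟 x y) : Indist 𝒟 y x := fun A hA => (h A hA).symm

theorem trans (h : Indist 𝒟 x y) (h' : Indist 𝒟 y z) : Indist 𝒟 x z :=
  fun A hA => (h A hA).trans (h' A hA)

theorem mono (h𝒟 : 𝒟 ⊆ 𝒟') (h : Indist 𝒟' x y) : Indist 𝒟 x y := fun A hA => h A (h𝒟 hA)

/-- Indistinguishability as an equivalence relation. -/
def setoid (𝒟 : Set (Set X)) : Setoid X where
  r := Indist 𝒟
  iseqv := ⟨refl 𝒟, symm, trans⟩

variable [LinearOrder X]

theorem left (h𝒟 : ∀ A ∈ 𝒟, IsLowerSet A) (h : Indist 𝒟 x z) (hxy : x ≤ y) (hyz : y ≤ z) :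
    Indist 𝒟 x y :=
  fun A hA => ⟨fun hx => h𝒟 A hA hyz ((h A hA).1 hx), fun hy => h𝒟 A hA hxy hy⟩

theorem right (h𝒟 : ∀ A ∈ 𝒟, IsLowerSet A) (h : Indist 𝒟 x z) (hxy : x ≤ y) (hyz : y ≤ z) :
    Indist 𝒟 y z :=
  (h.left h𝒟 hxy hyz).symm.trans h

theorem exists_of_not (h𝒟 : ∀ A ∈ 𝒟, IsLowerSet A) (h : ¬ Indist 𝒟 x y) (hxy : x ≤ y) :
    ∃ A ∈ 𝒟, x ∈ A ∧ y ∉ A := by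
  simp only [Indist, not_forall] at h
  obtain ⟨A, hA, h⟩ := h
  by_cases hx : x ∈ A
  · exact ⟨A, hA, hx, fun hy => h (iff_of_true hx hy)⟩
  · exact absurd (iff_of_false hx fun hy => hx (h𝒟 A hA hxy hy)) h

/-- Classes are order-convex, so of two distinct classes one lies entirely to the left of the other.
-/
theorem lt_of_not (h𝒟 : ∀ A ∈ 𝒟, IsLowerSet A) {x' y' : X} (h : ¬ Indist 𝒟 x y) (hxy : x < y)
    (hx : Indist 𝒟 x x') (hy : Indist 𝒟 y y') : x' < y' := by
  obtain ⟨A, hA, h1, h2⟩ := exists_of_not h𝒟 h hxy.le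
  by_contra h3
  exact h2 ((hy A hA).2 (h𝒟 A hA (not_lt.1 h3) ((hx A hA).1 h1)))

end Indist

section

variable {X : Type*} [LinearOrder X] [TopologicalSpace X] {𝒟 : Set (Set X)} {x y z : X}

theorem isLowerSet_of_mem_cuts : ∀ A ∈ {A : Set X | IsCut A}, IsLowerSet A := fun _ hA => hA.2

theorem Sim.left (h : Sim x z) (hxy : x ≤ y) (hyz : y ≤ z) : Sim x y :=
  Indist.left isLowerSet_of_mem_cuts h hxy hyz

theorem Sim.right (h : Sim x z) (hxy : x ≤ y) (hyz : y ≤ z) : Sim y z :=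
  Indist.right isLowerSet_of_mem_cuts h hxy hyz

theorem Sim.exists_cut (h : ¬ Sim x y) (hxy : x ≤ y) : ∃ A, IsCut A ∧ x ∈ A ∧ y ∉ A :=
  Indist.exists_of_not isLowerSet_of_mem_cuts h hxy

theorem IsCut.eventually {A : Set X} (hA : IsCut A) (x : X) : ∀ᶠ y in 𝓝 x, (x ∈ A ↔ y ∈ A) := by
  by_cases hx : x ∈ A
  · filter_upwards [hA.1.isOpen.mem_nhds hx] with y hy using iff_of_true hx hy
  · filter_upwards [hA.1.compl.isOpen.mem_nhds hx] with y hy using iff_of_false hx hy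

namespace IsCutFamily

theorem lower (h : IsCutFamily 𝒟) : ∀ A ∈ 𝒟, IsLowerSet A := fun A hA => (h.isCut A hA).2

theorem of_sim (h : IsCutFamily 𝒟) (hxy : Sim x y) : Indist 𝒟 x y :=
  Indist.mono (fun A hA => h.isCut A hA) hxy

theorem union {𝒟' : Set (Set X)} (h : IsCutFamily 𝒟) (h' : IsCutFamily 𝒟') :
    IsCutFamily (𝒟 ∪ 𝒟') where
  isCut A hA := hA.elim (h.isCut A) (h'.isCut A)
  eventually x := by
    filter_upwards [h.eventually x, h'.eventually x] with y hy hy' A hA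
    exact hA.elim (hy A) (hy' A)

/-- Every class of a cut family can be cut by finitely many further initial segments. -/
theorem exists_refinement (h : IsCutFamily 𝒟) (p : X → Set (Set X) → Prop)
    (hp : ∀ x, ∃ F : Set (Set X), F.Finite ∧ (∀ A ∈ F, IsCut A) ∧ p x F) :
    ∃ 𝒟', 𝒟 ⊆ 𝒟' ∧ IsCutFamily 𝒟' ∧ ∀ x, ∃ x₀ F, Indist 𝒟 x x₀ ∧ p x₀ F ∧
      ∀ u v, Indist 𝒟 x u → Indist 𝒟 x v → (Indist 𝒟' u v ↔ Indist F u v) := by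
  choose G hGfin hGcut hGp using hp
  -- All points of a class must use the same finite set of cuts, namely that of a representative.
  let rep : X → X := fun x => (Quotient.mk (Indist.setoid 𝒟) x).out
  have hrep : ∀ x, Indist 𝒟 x (rep x) := fun x =>
    Indist.symm (Quotient.mk_out (s := Indist.setoid 𝒟) x)
  have hrep' : ∀ x y, Indist 𝒟 x y → rep x = rep y := fun x y hxy => by
    have : Quotient.mk (Indist.setoid 𝒟) x = Quotient.mk (Indist.setoid 𝒟) y := Quotient.sound hxy
    simp only [rep, this]
  -- Only cuts that really split their class are added. Such an initial segment contains or misses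
  -- each other class as a whole, so classes do not interfere with each other.
  let 𝒟' := 𝒟 ∪ {A | ∃ x u v, A ∈ G (rep x) ∧ Indist 𝒟 x u ∧ Indist 𝒟 x v ∧ u ∈ A ∧ v ∉ A}
  have key : ∀ u v, Indist 𝒟 u v → Indist (G (rep u)) u v → Indist 𝒟' u v := by
    intro u v huv hG A hA
    rcases hA with hA | ⟨x, a, b, hA, hxa, hxb, ha, hb⟩
    · exact huv A hA
    · by_cases hxu : Indist 𝒟 x u
      · rw [hrep' x u hxu] at hA
        exact hG A hA
      · have hlow : IsLowerSet A := (hGcut _ A hA).2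
        rcases lt_or_gt_of_ne (show x ≠ u by rintro rfl; exact hxu (Indist.refl _ _)) with hlt | hlt
        · have h1 := Indist.lt_of_not h.lower hxu hlt hxb (Indist.refl _ _)
          have h2 := Indist.lt_of_not h.lower hxu hlt hxb huv
          exact iff_of_false (fun h => hb (hlow h1.le h)) (fun h => hb (hlow h2.le h))
        · have hxu' : ¬ Indist 𝒟 u x := fun h => hxu h.symm
          have h1 := Indist.lt_of_not h.lower hxu' hlt (Indist.refl _ _) hxa
          have h2 := Indist.lt_of_not h.lower hxu' hlt huv hxa
          exact iff_of_true (hlow h1.le ha) (hlow h2.le ha)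
  refine ⟨𝒟', subset_union_left, ⟨?_, ?_⟩, ?_⟩
  · rintro A (hA | ⟨x, -, -, hA, -⟩)
    exacts [h.isCut A hA, hGcut _ A hA]
  · intro x
    filter_upwards [h.eventually x, (Filter.eventually_all_finite (hGfin (rep x))).2
      fun A hA => (hGcut _ A hA).eventually x] with y hy hy'
    exact key x y hy hy'
  · intro x
    refine ⟨rep x, G (rep x), hrep x, hGp _, fun u v hu hv => ⟨fun huv A hA => ?_, fun huv => ?_⟩⟩
    · by_contra hne
      refine hne (huv A (Or.inr ?_))
      by_cases hu' : u ∈ A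
      · exact ⟨x, u, v, hA, hu, hv, hu', fun hv' => hne (iff_of_true hu' hv')⟩
      · refine ⟨x, v, u, hA, hv, hu, ?_, hu'⟩
        by_contra hv'
        exact hne (iff_of_false hu' hv')
    · exact key u v (hu.symm.trans hv) (by rwa [← hrep' x u hu])

end IsCutFamily

end

/-! ### Cut families that are fine up to quasi-components. -/

section

variable {X : Type*} [LinearOrder X] [MetricSpace X]

/-- A family whose classes are, up to `η`, determined by single quasi-components. -/
def IsFine (𝒟 : Set (Set X)) (η : ℝ) : Prop :=
  ∀ y z, Indist 𝒟 y z → ∃ s t, Sim s t ∧ dist y s < η ∧ dist z t < η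

/-- Every class contains at most one quasi-component of diameter at least `η`. -/
def BigUnique (𝒟 : Set (Set X)) (η : ℝ) : Prop :=
  ∀ a b a' b', Sim a b → Sim a' b' → Indist 𝒟 a a' → η ≤ dist a b → η ≤ dist a' b' → Sim a a'

theorem IsFine.mono {𝒟 𝒟' : Set (Set X)} {η : ℝ} (h : IsFine 𝒟 η) (h𝒟 : 𝒟 ⊆ 𝒟') : IsFine 𝒟' η :=
  fun y z hyz => h y z (hyz.mono h𝒟)

theorem BigUnique.mono {𝒟 𝒟' : Set (Set X)} {η : ℝ} (h : BigUnique 𝒟 η) (h𝒟 : 𝒟 ⊆ 𝒟') :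
    BigUnique 𝒟' η :=
  fun a b a' b' h1 h2 h3 => h a b a' b' h1 h2 (h3.mono h𝒟)

/-- An initial segment at positive distance from its complement is a cut. -/
theorem isCut_of_wide {A : Set X} {ε : ℝ} (hε : 0 < ε) (hA : IsLowerSet A)
    (h : ∀ a ∈ A, ∀ b ∉ A, ε ≤ dist a b) : IsCut A := by
  refine ⟨⟨?_, ?_⟩, hA⟩
  · rw [← isOpen_compl_iff, Metric.isOpen_iff]
    refine fun x hx => ⟨ε, hε, fun y hy hyA => ?_⟩
    exact (h y hyA x hx).not_gt hy
  · rw [Metric.isOpen_iff]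
    refine fun x hx => ⟨ε, hε, fun y hy => ?_⟩
    by_contra hyA
    rw [Metric.mem_ball, dist_comm] at hy
    exact (h x hx y hyA).not_gt hy

variable [IsConvexMetric X]

theorem dist_le_dist_of_le {a b c d : X} (hab : a ≤ b) (hbc : b ≤ c) (hcd : c ≤ d) :
    dist b c ≤ dist a d :=
  IsConvexMetric.dist_le_dist hab hbc hcd

/-- Monotonicity on intervals keeps points close to `x` and to `y < x` from appearing in the
opposite order. Hence open rays are open, although they need not generate the topology. -/
instance (priority := 50) IsConvexMetric.orderClosedTopology : OrderClosedTopology X := by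
  refine ⟨?_⟩
  rw [← isOpen_compl_iff, isOpen_iff_eventually]
  rintro ⟨x, y⟩ (hxy : ¬ x ≤ y)
  rw [not_le] at hxy
  have hd : 0 < dist y x := dist_pos.2 hxy.ne
  rw [nhds_prod_eq]
  filter_upwards [Filter.prod_mem_prod (Metric.ball_mem_nhds x (half_pos hd))
    (Metric.ball_mem_nhds y (half_pos hd))]
  rintro ⟨u, v⟩ ⟨hu, hv⟩ (huv : u ≤ v)
  rw [Metric.mem_ball] at hu hv
  rcases le_total x u with h | h
  · have := dist_le_dist_of_le le_rfl hxy.le (h.trans huv)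
    linarith [dist_comm y v]
  · rcases le_total v y with h' | h'
    · have := dist_le_dist_of_le (huv.trans h') hxy.le le_rfl
      linarith
    · rcases le_total u y with h1 | h1
      · have := dist_le_dist_of_le h1 hxy.le le_rfl
        linarith
      · have h2 := dist_le_dist_of_le le_rfl h1 huv
        have h3 := dist_triangle y u x
        linarith [dist_comm y v]

theorem exists_maximal_separated (X : Type*) [MetricSpace X] {ε : ℝ} (hε : 0 < ε) : ∃ S : Set X,
    (∀ s ∈ S, ∀ t ∈ S, dist s t < ε → s = t) ∧ ∀ y, ∃ s ∈ S, dist y s < ε := by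
  obtain ⟨S, hS⟩ := zorn_subset {S : Set X | ∀ s ∈ S, ∀ t ∈ S, dist s t < ε → s = t} (by
    intro c hc hchain
    refine ⟨⋃₀ c, ?_, fun s hs => subset_sUnion_of_mem hs⟩
    rintro s ⟨A, hA, hs⟩ t ⟨B, hB, ht⟩ hst
    rcases hchain.total hA hB with h | h
    · exact hc hB s (h hs) t ht hst
    · exact hc hA s hs t (h ht) hst)
  refine ⟨S, hS.prop, fun y => ?_⟩
  by_contra! hy
  have : y ∈ S := by
    refine hS.le_of_ge (y := insert y S) ?_ (subset_insert y S) (mem_insert y S)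
    rintro s (rfl | hs) t (rfl | ht) hst
    · rfl
    · exact absurd hst (hy t ht).not_gt
    · rw [dist_comm] at hst
      exact absurd hst (hy s hs).not_gt
    · exact hS.prop s hs t ht hst
  have := hy y this
  rw [dist_self] at this
  exact this.not_gt hε

end

section

variable {X : Type*} [LinearOrder X] [MetricSpace X]

/-- The initial segments whose distance from the complement is at least `ε`. -/
def wideCuts (X : Type*) [LinearOrder X] [MetricSpace X] (ε : ℝ) : Set (Set X) :=
  {A | IsLowerSet A ∧ ∀ a ∈ A, ∀ b ∉ A, ε ≤ dist a b}

theorem wideCuts_lower {ε : ℝ} : ∀ A ∈ wideCuts X ε, IsLowerSet A := fun _ hA => hA.1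

theorem indist_wideCuts_of_dist_lt {ε : ℝ} {x y : X} (h : dist x y < ε) :
    Indist (wideCuts X ε) x y := by
  intro A hA
  by_contra hne
  by_cases hx : x ∈ A
  · exact (hA.2 x hx y fun hy => hne (iff_of_true hx hy)).not_gt h
  · by_cases hy : y ∈ A
    · exact (hA.2 y hy x hx).not_gt (by rwa [dist_comm])
    · exact hne (iff_of_false hx hy)

theorem isCutFamily_wideCuts {ε : ℝ} (hε : 0 < ε) : IsCutFamily (wideCuts X ε) where
  isCut A hA := isCut_of_wide hε hA.1 hA.2
  eventually x := by
    filter_upwards [Metric.ball_mem_nhds x hε] with y hy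
    exact indist_wideCuts_of_dist_lt (by rwa [dist_comm])

/-- `s < t` are consecutive elements of `S` in different quasi-components, which are not
separated by a wide initial segment. -/
structure IsGap (S : Set X) (ε : ℝ) (s t : X) : Prop where
  left_mem : s ∈ S
  right_mem : t ∈ S
  lt : s < t
  adjacent : ∀ r ∈ S, r ≤ s ∨ t ≤ r
  not_sim : ¬ Sim s t
  indist : Indist (wideCuts X ε) s t

/-- Pairs of consecutive elements of `S` cannot overlap without being equal. -/
theorem IsGap.eq_of_lt {S : Set X} {ε : ℝ} {s t s' t' : X} (h : IsGap S ε s t)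
    (h' : IsGap S ε s' t') (h1 : s < t') (h2 : s' < t) : s = s' ∧ t = t' := by
  constructor
  · exact le_antisymm ((h'.adjacent s h.left_mem).resolve_right h1.not_ge)
      ((h.adjacent s' h'.left_mem).resolve_right h2.not_ge)
  · exact le_antisymm ((h.adjacent t' h'.right_mem).resolve_left h1.not_ge)
      ((h'.adjacent t h.right_mem).resolve_left h2.not_ge)

variable [IsConvexMetric X]

/-- A point between `s` and `t` is `ε`-close to an element of `S` outside the gap, hence to `s` or
to `t`. If the ends were `3 * ε` apart, these two groups would be `ε` apart and a wide initial
segment would separate `s` from `t`. -/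
theorem IsGap.dist_lt {S : Set X} {ε : ℝ} {s t : X} (hS : ∀ y, ∃ s ∈ S, dist y s < ε)
    (h : IsGap S ε s t) : dist s t < 3 * ε := by
  by_contra! hd
  obtain ⟨r, hr, hr'⟩ := hS s
  have hε : 0 < ε := dist_nonneg.trans_lt hr'
  let A : Set X := {z | z ≤ s ∨ (z < t ∧ dist s z < ε)}
  have hA : A ∈ wideCuts X ε := by
    refine ⟨?_, ?_⟩
    · rintro a b hba (ha | ⟨ha, ha'⟩)
      · exact Or.inl (hba.trans ha)
      · rcases le_total b s with h1 | h1
        · exact Or.inl h1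
        · exact Or.inr ⟨hba.trans_lt ha, (dist_le_dist_of_le le_rfl h1 hba).trans_lt ha'⟩
    · intro a ha b hb
      simp only [A, mem_ofPred_eq, not_or, not_and, not_lt, not_le] at ha hb
      obtain ⟨hsb, hb⟩ := hb
      rcases lt_or_ge b t with hbt | hbt
      · have hsb' := hb hbt
        obtain ⟨r, hr, hbr⟩ := hS b
        have hrt : t ≤ r := (h.adjacent r hr).resolve_left fun hrs => by
          have := dist_le_dist_of_le hrs hsb.le le_rfl
          linarith [dist_comm r b]
        have h1 : dist b t < ε := (dist_le_dist_of_le le_rfl hbt.le hrt).trans_lt hbr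
        have h2 := dist_triangle s b t
        rcases ha with ha | ⟨ha, ha'⟩
        · have := dist_le_dist_of_le ha hsb.le le_rfl
          linarith
        · have := dist_triangle s a b
          linarith
      · rcases ha with ha | ⟨ha, ha'⟩
        · have := dist_le_dist_of_le ha h.lt.le hbt
          linarith
        · have h1 := dist_le_dist_of_le le_rfl ha.le hbt
          have h2 := dist_triangle s a t
          linarith
  rcases (h.indist A hA).1 (Or.inl le_rfl) with h1 | h1
  · exact h1.not_gt h.lt
  · exact lt_irrefl _ h1.1

/-- Between indistinguishable points, a separated set is finite. -/
theorem finite_inter_Icc {S : Set X} {ε : ℝ} (hS : ∀ s ∈ S, ∀ t ∈ S, dist s t < ε → s = t)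
    {s t : X} (hst : Indist (wideCuts X ε) s t) : (S ∩ Icc s t).Finite := by
  -- A move of length less than `ε` meets at most one more element of `S`, so finiteness cannot be
  -- lost across a narrow gap.
  have hB : {z | (S ∩ Icc s z).Finite} ∈ wideCuts X ε := by
    refine ⟨fun a b hba ha => ha.subset (inter_subset_inter_right _ (Icc_subset_Icc_right hba)),
      fun a ha b hb => ?_⟩
    by_contra! hab
    refine hb ((ha.union (t := S ∩ Icc a b) ?_).subset ?_)
    · refine Set.Subsingleton.finite fun u hu v hv => hS u hu.1 v hv.1 ?_
      rcases le_total u v with huv | huv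
      · exact (dist_le_dist_of_le hu.2.1 huv hv.2.2).trans_lt hab
      · rw [dist_comm]
        exact (dist_le_dist_of_le hv.2.1 huv hu.2.2).trans_lt hab
    · rintro z ⟨hz, h1, h2⟩
      rcases le_total z a with h | h
      exacts [Or.inl ⟨hz, h1, h⟩, Or.inr ⟨hz, h, h2⟩]
  refine (hst _ hB).1 (Set.Subsingleton.finite fun u hu v hv => ?_)
  rw [le_antisymm hu.2.2 hu.2.1, le_antisymm hv.2.2 hv.2.1]

/-- There are cut families which are arbitrarily fine up to quasi-components. -/
theorem exists_isFine {η : ℝ} (hη : 0 < η) :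
    ∃ 𝒟 : Set (Set X), IsCutFamily 𝒟 ∧ IsFine 𝒟 η ∧ BigUnique 𝒟 η := by
  obtain ⟨ε, hε, rfl⟩ : ∃ ε, 0 < ε ∧ η = 3 * ε := ⟨η / 3, by positivity, by ring⟩
  obtain ⟨S, hSsep, hSmax⟩ := exists_maximal_separated X hε
  have hex : ∀ s t : X, IsGap S ε s t → ∃ A, IsCut A ∧ s ∈ A ∧ t ∉ A := fun s t h =>
    Sim.exists_cut h.not_sim h.lt.le
  choose! c hcut hcl hcr using hex
  -- One cut is chosen in every gap. Together with the wide cuts they separate elements of `S` from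
  -- different quasi-components.
  let 𝒞 : Set (Set X) := {A | ∃ s t, IsGap S ε s t ∧ A = c s t}
  have h𝒞cut : ∀ A ∈ 𝒞, IsCut A := by
    rintro _ ⟨s, t, h, rfl⟩
    exact hcut s t h
  have hbetween : ∀ s t, IsGap S ε s t → ∀ x y, x ∈ c s t → y ∉ c s t → x < t ∧ s < y := by
    intro s t h x y hx hy
    refine ⟨?_, ?_⟩
    · by_contra! h1
      exact hcr s t h ((hcut s t h).2 h1 hx)
    · by_contra! h1
      exact hy ((hcut s t h).2 h1 (hcl s t h))
  have hw := isCutFamily_wideCuts (X := X) hε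
  have h𝒞 : IsCutFamily 𝒞 := by
    refine ⟨h𝒞cut, fun x => ?_⟩
    let U := Metric.ball x (ε / 2)
    have hU : ∀ u ∈ S, ∀ v ∈ S, u ∈ U → v ∈ U → u = v := by
      intro u hu v hv hu' hv'
      refine hSsep u hu v hv ?_
      simp only [U, Metric.mem_ball] at hu' hv'
      linarith [dist_triangle_right u v x]
    have hconv : ∀ y ∈ U, ∀ z, x ≤ z → z ≤ y → z ∈ U := by
      intro y hy z hxz hzy
      simp only [U, Metric.mem_ball, dist_comm _ x] at hy ⊢
      exact (dist_le_dist_of_le le_rfl hxz hzy).trans_lt hy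
    have hconv' : ∀ y ∈ U, ∀ z, y ≤ z → z ≤ x → z ∈ U := by
      intro y hy z hyz hzx
      simp only [U, Metric.mem_ball] at hy ⊢
      exact (dist_le_dist_of_le hyz hzx le_rfl).trans_lt hy
    -- A chosen cut separating `x` from a point of `U` belongs to a gap that has an end in `U` or
    -- surrounds `x`. As `U` has at most one point of `S`, there is at most one cut of each of the
    -- three kinds.
    let Q : Set (Set X) := {A | ∃ s t, IsGap S ε s t ∧ A = c s t ∧ s ∈ U} ∪
      {A | ∃ s t, IsGap S ε s t ∧ A = c s t ∧ t ∈ U} ∪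
      {A | ∃ s t, IsGap S ε s t ∧ A = c s t ∧ s < x ∧ x < t}
    have hQ : Q.Finite := by
      refine (Set.Finite.union ?_ ?_).union ?_ <;> refine Set.Subsingleton.finite ?_
      · rintro _ ⟨s, t, h, rfl, hs⟩ _ ⟨s', t', h', rfl, hs'⟩
        obtain rfl := hU s h.left_mem s' h'.left_mem hs hs'
        rw [(h.eq_of_lt h' h'.lt h.lt).2]
      · rintro _ ⟨s, t, h, rfl, hs⟩ _ ⟨s', t', h', rfl, hs'⟩
        obtain rfl := hU t h.right_mem t' h'.right_mem hs hs'
        rw [(h.eq_of_lt h' h.lt h'.lt).1]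
      · rintro _ ⟨s, t, h, rfl, hs, ht⟩ _ ⟨s', t', h', rfl, hs', ht'⟩
        obtain ⟨rfl, rfl⟩ := h.eq_of_lt h' (hs.trans ht') (hs'.trans ht)
        rfl
    have hQcut : ∀ A ∈ Q, IsCut A := by
      rintro _ ((⟨s, t, h, rfl, -⟩ | ⟨s, t, h, rfl, -⟩) | ⟨s, t, h, rfl, -⟩) <;> exact hcut s t h
    filter_upwards [Metric.ball_mem_nhds x (half_pos hε), (Filter.eventually_all_finite hQ).2
      fun A hA => (hQcut A hA).eventually x] with y hyU hyQ A hA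
    by_cases hAQ : A ∈ Q
    · exact hyQ A hAQ
    obtain ⟨s, t, h, rfl⟩ := hA
    have hsU : s ∉ U := fun hs => hAQ (Or.inl (Or.inl ⟨s, t, h, rfl, hs⟩))
    have htU : t ∉ U := fun ht => hAQ (Or.inl (Or.inr ⟨s, t, h, rfl, ht⟩))
    by_contra hne
    refine hAQ (Or.inr ⟨s, t, h, rfl, ?_⟩)
    by_cases hx : x ∈ c s t
    · obtain ⟨h1, h2⟩ := hbetween s t h x y hx fun hy => hne (iff_of_true hx hy)
      exact ⟨not_le.1 fun h3 => hsU (hconv y hyU s h3 h2.le), h1⟩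
    · have hy : y ∈ c s t := by
        by_contra hy
        exact hne (iff_of_false hx hy)
      obtain ⟨h1, h2⟩ := hbetween s t h y x hy hx
      exact ⟨h2, not_le.1 fun h3 => htU (hconv' y hyU t h1.le h3)⟩
  let 𝒟 := wideCuts X ε ∪ 𝒞
  have h𝒟 : IsCutFamily 𝒟 := hw.union h𝒞
  -- a gap splits into the points indistinguishable from its two ends
  have hgap : ∀ s t, IsGap S ε s t → ∀ y, s ≤ y → y ≤ t →
      (y ∈ c s t → Indist 𝒟 y s) ∧ (y ∉ c s t → Indist 𝒟 y t) := by
    intro s t h y hsy hyt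
    have hother : ∀ A ∈ 𝒞, A ≠ c s t → (s ∈ A ↔ t ∈ A) := by
      rintro _ ⟨s', t', h', rfl⟩ hne
      by_contra hsep
      have hsA : s ∈ c s' t' := by
        by_contra hs
        exact hsep (iff_of_false hs fun ht => hs ((hcut _ _ h').2 h.lt.le ht))
      have htA : t ∉ c s' t' := fun ht => hsep (iff_of_true hsA ht)
      obtain ⟨h1, h2⟩ := hbetween s' t' h' s t hsA htA
      obtain ⟨rfl, rfl⟩ := h.eq_of_lt h' h1 h2
      exact hne rfl
    have hmem : ∀ A, IsLowerSet A → (s ∈ A ↔ t ∈ A) → (y ∈ A ↔ s ∈ A) ∧ (y ∈ A ↔ t ∈ A) := by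
      intro A hA hst
      have h1 : y ∈ A → s ∈ A := fun h => hA hsy h
      have h2 : t ∈ A → y ∈ A := fun h => hA hyt h
      tauto
    refine ⟨fun hy A hA => ?_, fun hy A hA => ?_⟩ <;>
    by_cases hAc : A = c s t
    · exact iff_of_true (hAc ▸ hy) (hAc ▸ hcl s t h)
    · exact (hmem A (h𝒟.lower A hA) (hA.elim (h.indist A) fun hA => hother A hA hAc)).1
    · exact iff_of_false (hAc ▸ hy) (hAc ▸ hcr s t h)
    · exact (hmem A (h𝒟.lower A hA) (hA.elim (h.indist A) fun hA => hother A hA hAc)).2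
  -- If `y` is cut off from the nearby element `r` of `S`, the cut comes from a gap around `y`. The
  -- end of this gap on the same side of the cut replaces `r`, at the cost of `3 * ε`, the bound on
  -- the length of a gap.
  have hnear : ∀ y, ∃ s ∈ S, Indist 𝒟 y s ∧ dist y s < 3 * ε := by
    intro y
    obtain ⟨r, hr, hyr⟩ := hSmax y
    by_cases hind : Indist 𝒟 y r
    · exact ⟨r, hr, hind, by linarith⟩
    have hindw := indist_wideCuts_of_dist_lt hyr
    simp only [Indist, not_forall] at hind
    obtain ⟨A, hA | ⟨s, t, h, rfl⟩, hne⟩ := hind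
    · exact absurd (hindw A hA) hne
    have hst := h.dist_lt hSmax
    have hsy : s ≤ y ∧ y ≤ t := by
      by_cases hy : y ∈ c s t
      · obtain ⟨h1, h2⟩ := hbetween s t h y r hy fun hr' => hne (iff_of_true hy hr')
        refine ⟨?_, h1.le⟩
        by_contra! h3
        refine h2.ne (hSsep s h.left_mem r hr ?_)
        exact (dist_le_dist_of_le h3.le h2.le le_rfl).trans_lt hyr
      · have hr' : r ∈ c s t := by
          by_contra hr'
          exact hne (iff_of_false hy hr')
        obtain ⟨h1, h2⟩ := hbetween s t h r y hr' hy
        refine ⟨h2.le, ?_⟩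
        by_contra! h3
        refine h1.ne (hSsep r hr t h.right_mem ?_)
        rw [dist_comm] at hyr
        exact (dist_le_dist_of_le le_rfl h1.le h3.le).trans_lt hyr
    by_cases hy : y ∈ c s t
    · refine ⟨s, h.left_mem, (hgap s t h y hsy.1 hsy.2).1 hy, ?_⟩
      rw [dist_comm]
      exact (dist_le_dist_of_le le_rfl hsy.1 hsy.2).trans_lt hst
    · exact ⟨t, h.right_mem, (hgap s t h y hsy.1 hsy.2).2 hy,
        (dist_le_dist_of_le hsy.1 hsy.2 le_rfl).trans_lt hst⟩
  -- Only finitely many elements of `S` lie between `s` and `t`; a cut separating `s` from `t` would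
  -- thus pass through a gap, whose chosen cut also separates them.
  have hSsim' : ∀ s ∈ S, ∀ t ∈ S, s ≤ t → Indist 𝒟 s t → Sim s t := by
    intro s hs t ht hst hind
    by_contra hns
    obtain ⟨A, hA, hsA, htA⟩ := Sim.exists_cut hns hst
    have hfin := finite_inter_Icc hSsep (hind.mono subset_union_left)
    obtain ⟨a, ⟨⟨ha1, ha2⟩, ha3⟩, ha4⟩ := Set.exists_max_image (S ∩ Icc s t ∩ A) id
      (hfin.subset inter_subset_left) ⟨s, ⟨hs, le_rfl, hst⟩, hsA⟩
    obtain ⟨b, ⟨⟨hb1, hb2⟩, hb3⟩, hb4⟩ := Set.exists_min_image (S ∩ Icc s t ∩ Aᶜ) id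
      (hfin.subset inter_subset_left) ⟨t, ⟨ht, hst, le_rfl⟩, htA⟩
    have hab : a < b := by
      by_contra! h
      exact hb3 (hA.2 h ha3)
    have hgap : IsGap S ε a b := by
      refine ⟨ha1, hb1, hab, fun r hr => ?_, fun h => hb3 ((h A hA).1 ha3), ?_⟩
      · rcases lt_or_ge r s with h1 | h1
        · exact Or.inl (h1.le.trans ha2.1)
        rcases lt_or_ge t r with h2 | h2
        · exact Or.inr (hb2.2.trans h2.le)
        by_cases hrA : r ∈ A
        · exact Or.inl (ha4 r ⟨⟨hr, h1, h2⟩, hrA⟩)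
        · exact Or.inr (hb4 r ⟨⟨hr, h1, h2⟩, hrA⟩)
      · have h1 : Indist (wideCuts X ε) s t := hind.mono subset_union_left
        exact (h1.right wideCuts_lower ha2.1 ha2.2).left wideCuts_lower hab.le hb2.2
    have h1 : s ∈ c a b := (hcut a b hgap).2 ha2.1 (hcl a b hgap)
    exact hcr a b hgap ((hcut a b hgap).2 hb2.2 ((hind _ (Or.inr ⟨a, b, hgap, rfl⟩)).1 h1))
  have hSsim : ∀ s ∈ S, ∀ t ∈ S, Indist 𝒟 s t → Sim s t := by
    intro s hs t ht hind
    rcases le_total s t with h | h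
    · exact hSsim' s hs t ht h hind
    · exact (hSsim' t ht s hs h hind.symm).symm
  -- The elements of `S` near `u` and `v` share a quasi-component. Either one of them lies in `[u,
  -- v]` or they enclose it, since passing beyond the opposite end would require distance `3 * ε`.
  have hbig' : ∀ u v, u ≤ v → Sim u v → 3 * ε ≤ dist u v → ∃ s ∈ S, Sim u s := by
    intro u v huv hsim hd
    obtain ⟨s, hs, hus, hds⟩ := hnear u
    obtain ⟨t, ht, hvt, hdt⟩ := hnear v
    have hst : Sim s t := hSsim s hs t ht (hus.symm.trans ((h𝒟.of_sim hsim).trans hvt))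
    rcases le_total s u with h1 | h1
    · rcases le_total t v with h2 | h2
      · rcases le_total u t with h3 | h3
        · exact ⟨t, ht, hsim.left h3 h2⟩
        · have := dist_le_dist_of_le h3 huv le_rfl
          rw [dist_comm t v] at this
          linarith
      · exact ⟨s, hs, (hst.left h1 (huv.trans h2)).symm⟩
    · rcases le_total s v with h2 | h2
      · exact ⟨s, hs, hsim.left h1 h2⟩
      · have := dist_le_dist_of_le le_rfl huv h2
        linarith
  have hbig : ∀ u v, Sim u v → 3 * ε ≤ dist u v → ∃ s ∈ S, Sim u s := by
    intro u v hsim hd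
    rcases le_total u v with h | h
    · exact hbig' u v h hsim hd
    · obtain ⟨s, hs, hvs⟩ := hbig' v u h hsim.symm (by rwa [dist_comm])
      exact ⟨s, hs, hsim.trans hvs⟩
  refine ⟨𝒟, h𝒟, fun y z hyz => ?_, fun a b a' b' hab hab' haa' hd hd' => ?_⟩
  · obtain ⟨s, hs, hys, hds⟩ := hnear y
    obtain ⟨t, ht, hzt, hdt⟩ := hnear z
    exact ⟨s, t, hSsim s hs t ht (hys.symm.trans (hyz.trans hzt)), hds, hdt⟩
  · obtain ⟨s, hs, has⟩ := hbig a b hab hd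
    obtain ⟨t, ht, hat⟩ := hbig a' b' hab' hd'
    exact has.trans ((hSsim s hs t ht
      ((h𝒟.of_sim has).symm.trans (haa'.trans (h𝒟.of_sim hat)))).trans hat.symm)

end

/-! ### Counting pieces and quasi-components in a class. -/

section

variable {X : Type*}

/-- The set `V` meets at least three classes. -/
def HasThreePieces (𝒟 : Set (Set X)) (V : Set X) : Prop :=
  ∃ a ∈ V, ∃ b ∈ V, ∃ c ∈ V, ¬ Indist 𝒟 a b ∧ ¬ Indist 𝒟 a c ∧ ¬ Indist 𝒟 b c

theorem HasThreePieces.mono {𝒟 𝒟' : Set (Set X)} {V W : Set X} (h : HasThreePieces 𝒟 V)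
    (hV : V ⊆ W) (h𝒟 : ∀ u ∈ V, ∀ v ∈ V, Indist 𝒟' u v → Indist 𝒟 u v) :
    HasThreePieces 𝒟' W := by
  obtain ⟨a, ha, b, hb, c, hc, h1, h2, h3⟩ := h
  exact ⟨a, hV ha, b, hV hb, c, hV hc, fun h => h1 (h𝒟 a ha b hb h),
    fun h => h2 (h𝒟 a ha c hc h), fun h => h3 (h𝒟 b hb c hc h)⟩

theorem exists_tournament_on {𝒟 : Set (Set X)} {V : Set X} (h : V = ∅ ∨ HasThreePieces 𝒟 V) :
    ∃ t : X → X → Prop,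
      (∀ u ∈ V, ∀ v ∈ V, ∀ u' ∈ V, ∀ v' ∈ V, Indist 𝒟 u u' → Indist 𝒟 v v' → t u v → t u' v') ∧
      (∀ u ∈ V, ∀ v ∈ V, ¬ Indist 𝒟 u v → (t u v ↔ ¬ t v u)) ∧
      (∀ u ∈ V, ∃ F ⊆ V, F.Finite ∧ (∀ w ∈ F, ¬ Indist 𝒟 u w) ∧ ∀ y ∈ V, ¬ Indist 𝒟 u y →
        ∃ w ∈ F, ¬ Indist 𝒟 y w ∧ ((t w u ∧ t y w) ∨ (t u w ∧ t w y))) ∧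
      (∃ F ⊆ V, F.Finite ∧ ∀ y ∈ V, ∃ w ∈ F, ¬ Indist 𝒟 y w ∧ t w y) := by
  rcases h with rfl | ⟨a, ha, b, hb, c, hc, hab, hac, hbc⟩
  · exact ⟨fun _ _ => True, by simp, by simp, by simp, ∅, by simp⟩
  · exact exists_isolatingTournament_setoid (Indist.setoid 𝒟) V ha hb hc hab hac hbc

end

section

variable {X : Type*} [LinearOrder X] [TopologicalSpace X]

/-- The points strictly to the left of the quasi-component of `a`. -/
def leftEnd (a : X) : Set X := {z | z < a ∧ ¬ Sim z a}

/-- The points to the left of or inside the quasi-component of `a`. -/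
def rightEnd (a : X) : Set X := {z | z ≤ a ∨ Sim z a}

theorem leftEnd_congr {a b : X} (h : Sim a b) : leftEnd a = leftEnd b := by
  have key : ∀ a b : X, Sim a b → leftEnd a ⊆ leftEnd b := by
    rintro a b h z ⟨hza, hz⟩
    refine ⟨?_, fun hzb => hz (hzb.trans h.symm)⟩
    by_contra! hbz
    exact hz (Sim.right h.symm hbz hza.le)
  exact (key a b h).antisymm (key b a h.symm)

theorem rightEnd_congr {a b : X} (h : Sim a b) : rightEnd a = rightEnd b := by
  have key : ∀ a b : X, Sim a b → rightEnd a ⊆ rightEnd b := by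
    rintro a b h z (hz | hz)
    · rcases le_total z b with hzb | hbz
      · exact Or.inl hzb
      · exact Or.inr (Sim.left h.symm hbz hz).symm
    · exact Or.inr (hz.trans h)
  exact (key a b h).antisymm (key b a h.symm)

/-- The class of `x` contains three points in different quasi-components. -/
def HasThreeComponents (𝒟 : Set (Set X)) (x : X) : Prop :=
  ∃ a b c, Indist 𝒟 x a ∧ Indist 𝒟 x b ∧ Indist 𝒟 x c ∧ a < b ∧ b < c ∧ ¬ Sim a b ∧ ¬ Sim b c

/-- Two pieces carry no isolating tournament, so a class with exactly two quasi-components is cut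
into these; all other classes are left alone. -/
theorem IsCutFamily.exists_split {𝒟 : Set (Set X)} (h𝒟 : IsCutFamily 𝒟) :
    ∃ 𝒟', 𝒟 ⊆ 𝒟' ∧ IsCutFamily 𝒟' ∧
      ∀ x, (∀ y, Indist 𝒟' x y → Sim x y) ∨ HasThreeComponents 𝒟' x := by
  obtain ⟨𝒟', hsub, h𝒟', h⟩ := h𝒟.exists_refinement (fun x F =>
    (∀ u v, Indist 𝒟 x u → Indist 𝒟 x v → Indist F u v → Sim u v) ∨
      (HasThreeComponents 𝒟 x ∧ F = ∅)) (by
    intro x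
    by_cases h3 : HasThreeComponents 𝒟 x
    · exact ⟨∅, finite_empty, by simp, Or.inr ⟨h3, rfl⟩⟩
    by_cases h2 : ∃ a b, Indist 𝒟 x a ∧ Indist 𝒟 x b ∧ a < b ∧ ¬ Sim a b
    · obtain ⟨a, b, ha, hb, hab, hsim⟩ := h2
      obtain ⟨A, hA, haA, hbA⟩ := Sim.exists_cut hsim hab.le
      refine ⟨{A}, finite_singleton A, by simpa using hA, Or.inl ?_⟩
      have key : ∀ u v, Indist 𝒟 x u → Indist 𝒟 x v → Indist {A} u v → u < v → Sim u v := by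
        intro u v hu hv huv hlt
        by_contra hns
        by_cases hvA : v ∈ A
        · refine h3 ⟨u, v, b, hu, hv, hb, hlt, ?_, hns, fun h => hbA ((h A hA).1 hvA)⟩
          by_contra! h
          exact hbA (hA.2 h hvA)
        · have huA : u ∉ A := fun h => hvA ((huv A rfl).1 h)
          refine h3 ⟨a, u, v, ha, hu, hv, ?_, hlt, fun h => huA ((h A hA).1 haA), hns⟩
          by_contra! h
          exact huA (hA.2 h haA)
      intro u v hu hv huv
      rcases lt_trichotomy u v with h | rfl | h
      · exact key u v hu hv huv h
      · exact Indist.refl _ _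
      · exact (key v u hv hu huv.symm h).symm
    · refine ⟨∅, finite_empty, by simp, Or.inl fun u v hu hv _ => ?_⟩
      push Not at h2
      rcases lt_trichotomy u v with h | rfl | h
      · exact h2 u v hu hv h
      · exact Indist.refl _ _
      · exact (h2 v u hv hu h).symm)
  refine ⟨𝒟', hsub, h𝒟', fun x => ?_⟩
  obtain ⟨x₀, F, hx, hF | ⟨⟨a, b, c, ha, hb, hc, h1⟩, rfl⟩, hF'⟩ := h x
  · refine Or.inl fun y hy => ?_
    have hy' := hy.mono hsub
    exact hF x y hx.symm (hx.symm.trans hy') ((hF' x y (Indist.refl _ _) hy').1 hy)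
  · have : ∀ u, Indist 𝒟 x₀ u → Indist 𝒟' x u := fun u hu =>
      (hF' x u (Indist.refl _ _) (hx.trans hu)).2 (by simp [Indist])
    exact Or.inr ⟨a, b, c, this a ha, this b hb, this c hc, h1⟩

end

/-! ### Admissible families and their refinement. -/

section

variable {X : Type*} [LinearOrder X] [MetricSpace X]

/-- A class has at most one big quasi-component, and the two ends depend only on this, so at most
two further cuts per class are needed. -/
theorem IsCutFamily.exists_ends {𝒟 : Set (Set X)} {η : ℝ} (h𝒟 : IsCutFamily 𝒟)
    (hbig : BigUnique 𝒟 η) : ∃ 𝒟', 𝒟 ⊆ 𝒟' ∧ IsCutFamily 𝒟' ∧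
      ∀ a b x, Sim a b → η ≤ dist a b → Indist 𝒟' x a →
        (IsCut (leftEnd a) → x ∉ leftEnd a) ∧ (IsCut (rightEnd a) → x ∈ rightEnd a) := by
  obtain ⟨𝒟', hsub, h𝒟', h⟩ := h𝒟.exists_refinement (fun x F =>
    ∀ a b, Indist 𝒟 x a → Sim a b → η ≤ dist a b →
      (IsCut (leftEnd a) → leftEnd a ∈ F) ∧ (IsCut (rightEnd a) → rightEnd a ∈ F)) (by
    intro x
    by_cases hx : ∃ a b, Indist 𝒟 x a ∧ Sim a b ∧ η ≤ dist a b
    · obtain ⟨a₀, b₀, ha₀, hab₀, hd₀⟩ := hx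
      refine ⟨{A | A ∈ ({leftEnd a₀, rightEnd a₀} : Set (Set X)) ∧ IsCut A},
        (toFinite _).subset (sep_subset _ _), fun A hA => hA.2, fun a b ha hab hd => ?_⟩
      have hsim : Sim a a₀ := hbig a b a₀ b₀ hab hab₀ (ha.symm.trans ha₀) hd hd₀
      exact ⟨fun h => ⟨Or.inl (leftEnd_congr hsim), h⟩,
        fun h => ⟨Or.inr (rightEnd_congr hsim), h⟩⟩
    · exact ⟨∅, finite_empty, by simp, fun a b ha hab hd => absurd ⟨a, b, ha, hab, hd⟩ hx⟩)
  refine ⟨𝒟', hsub, h𝒟', fun a b x hab hd hxa => ?_⟩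
  obtain ⟨x₀, F, hx, hF, hF'⟩ := h x
  have hxa' := hxa.mono hsub
  have h1 := hF a b (hx.symm.trans hxa') hab hd
  have h2 := (hF' x a (Indist.refl _ _) hxa').1 hxa
  exact ⟨fun hc hxl => lt_irrefl _ ((h2 _ (h1.1 hc)).1 hxl).1,
    fun hc => (h2 _ (h1.2 hc)).2 (Or.inl le_rfl)⟩

/-- A cut family that can be refined further: classes which are not quasi-components have at least
three of these, and at most one of diameter at least `η`, whose clopen ends have been cut off. -/
structure IsAdmissible (𝒟 : Set (Set X)) (η : ℝ) : Prop extends IsCutFamily 𝒟 where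
  big : BigUnique 𝒟 η
  ends : ∀ a b x, Sim a b → η ≤ dist a b → Indist 𝒟 x a →
    (IsCut (leftEnd a) → x ∉ leftEnd a) ∧ (IsCut (rightEnd a) → x ∈ rightEnd a)
  count : ∀ x, (∀ y, Indist 𝒟 x y → Sim x y) ∨ HasThreeComponents 𝒟 x

/-- The family `𝒟'` cuts the `𝒟`-class of `x` into sufficiently many pieces, on either side of its
big quasi-component. -/
def Subdivides (𝒟 𝒟' : Set (Set X)) (η : ℝ) (x : X) : Prop :=
  (∀ y, Indist 𝒟 x y → Sim x y) ∨
  ((∀ a b, Indist 𝒟 x a → Sim a b → dist a b < η) ∧ HasThreePieces 𝒟' {y | Indist 𝒟 x y}) ∨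
  ∃ k k', Indist 𝒟 x k ∧ Sim k k' ∧ η ≤ dist k k' ∧
    ((∀ y, Indist 𝒟 x y → y < k → Sim y k) ∨
      HasThreePieces 𝒟' {y | Indist 𝒟 x y ∧ y < k ∧ ¬ Indist 𝒟' y k}) ∧
    ((∀ y, Indist 𝒟 x y → k < y → Sim y k) ∨
      HasThreePieces 𝒟' {y | Indist 𝒟 x y ∧ k < y ∧ ¬ Indist 𝒟' y k})

theorem Subdivides.mono {𝒟 F 𝒟' : Set (Set X)} {η : ℝ} {x x₀ : X} (h : Subdivides 𝒟 F η x₀)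
    (hx : Indist 𝒟 x x₀)
    (hF : ∀ u v, Indist 𝒟 x u → Indist 𝒟 x v → Indist 𝒟' u v → Indist F u v) :
    Subdivides 𝒟 𝒟' η x := by
  have h1 : ∀ y, Indist 𝒟 x y → Indist 𝒟 x₀ y := fun y hy => hx.symm.trans hy
  rcases h with h | ⟨h, h'⟩ | ⟨k, k', hk, hkk', hd, hl, hr⟩
  · exact Or.inl fun y hy => (h x hx.symm).symm.trans (h y (h1 y hy))
  · exact Or.inr (Or.inl ⟨fun a b ha => h a b (h1 a ha), h'.mono (fun y hy => hx.trans hy)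
      fun u hu v hv => hF u v (hx.trans hu) (hx.trans hv)⟩)
  · refine Or.inr (Or.inr ⟨k, k', hx.trans hk, hkk', hd, hl.imp ?_ ?_, hr.imp ?_ ?_⟩)
    · exact fun h y hy => h y (h1 y hy)
    · exact fun h => h.mono (fun y hy => ⟨hx.trans hy.1, hy.2.1, fun h2 =>
        hy.2.2 (hF _ _ (hx.trans hy.1) (hx.trans hk) h2)⟩)
        fun u hu v hv => hF u v (hx.trans hu.1) (hx.trans hv.1)
    · exact fun h y hy => h y (h1 y hy)
    · exact fun h => h.mono (fun y hy => ⟨hx.trans hy.1, hy.2.1, fun h2 =>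
        hy.2.2 (hF _ _ (hx.trans hy.1) (hx.trans hk) h2)⟩)
        fun u hu v hv => hF u v (hx.trans hu.1) (hx.trans hv.1)

namespace IsAdmissible

variable {𝒟 : Set (Set X)} {η : ℝ}

/-- If nothing remained between `A` and the quasi-component of `k`, then `leftEnd k` would be the
cut `A`, and it would already have been removed from the class of `k`, which contains `y`. -/
theorem exists_left (h : IsAdmissible 𝒟 η) {y k k' : X} (hk : Sim k k') (hd : η ≤ dist k k')
    (hy : Indist 𝒟 y k) {A : Set X} (hA : IsCut A) (hyA : y ∈ A) (hkA : k ∉ A) :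
    ∃ z, Indist 𝒟 z k ∧ z < k ∧ z ∉ A ∧ ¬ Sim z k := by
  by_contra! hno
  have hlt : ∀ z ∈ A, z < k := fun z hz => by
    by_contra! hkz
    exact hkA (hA.2 hkz hz)
  have hsub : leftEnd k = A := by
    ext z
    refine ⟨fun ⟨hzk, hz⟩ => ?_, fun hz => ⟨hlt z hz, fun hs => hkA ((hs A hA).1 hz)⟩⟩
    by_contra hzA
    have hyz : y ≤ z := by
      by_contra! hzy
      exact hzA (hA.2 hzy.le hyA)
    exact hz (hno z (hy.right h.lower hyz hzk.le) hzk hzA)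
  exact (h.ends k k' y hk hd hy).1 (hsub ▸ hA) (hsub ▸ hyA)

theorem exists_right (h : IsAdmissible 𝒟 η) {y k k' : X} (hk : Sim k k') (hd : η ≤ dist k k')
    (hy : Indist 𝒟 y k) {A : Set X} (hA : IsCut A) (hyA : y ∉ A) (hkA : k ∈ A) :
    ∃ z, Indist 𝒟 z k ∧ k < z ∧ z ∈ A ∧ ¬ Sim z k := by
  by_contra! hno
  have hsub : rightEnd k = A := by
    ext z
    constructor
    · rintro (hz | hz)
      · exact hA.2 hz hkA
      · exact (hz A hA).2 hkA
    · intro hz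
      rcases le_or_gt z k with hzk | hkz
      · exact Or.inl hzk
      have hzy : z ≤ y := by
        by_contra! hyz
        exact hyA (hA.2 hyz.le hz)
      exact Or.inr (hno z (hy.symm.left h.lower hkz.le hzy).symm hkz hz)
  exact hyA (hsub ▸ (h.ends k k' y hk hd hy).2 (hsub ▸ hA))

/-- Moving towards the big quasi-component by `exists_left` gives cuts `A`, `B`, `C` that separate
three successive points from each other and from `k`. -/
theorem exists_left_pieces (h : IsAdmissible 𝒟 η) {x k k' : X} (hk : Sim k k')
    (hd : η ≤ dist k k') (hx : Indist 𝒟 x k) : ∃ F : Set (Set X), F.Finite ∧ (∀ A ∈ F, IsCut A) ∧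
      ((∀ y, Indist 𝒟 x y → y < k → Sim y k) ∨
        HasThreePieces F {y | Indist 𝒟 x y ∧ y < k ∧ ¬ Indist F y k}) := by
  by_cases hno : ∀ y, Indist 𝒟 x y → y < k → Sim y k
  · exact ⟨∅, finite_empty, by simp, Or.inl hno⟩
  push Not at hno
  obtain ⟨a, ha, hak, has⟩ := hno
  obtain ⟨A, hA, haA, hkA⟩ := Sim.exists_cut has hak.le
  obtain ⟨b, hb, hbk, hbA, hbs⟩ := h.exists_left hk hd (ha.symm.trans hx) hA haA hkA
  obtain ⟨B, hB, hbB, hkB⟩ := Sim.exists_cut hbs hbk.le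
  obtain ⟨c, hc, hck, hcB, hcs⟩ := h.exists_left hk hd hb hB hbB hkB
  obtain ⟨C, hC, hcC, hkC⟩ := Sim.exists_cut hcs hck.le
  have hcA : c ∉ A := fun hcA => by
    rcases le_total b c with hbc | hcb
    · exact hbA (hA.2 hbc hcA)
    · exact hcB (hB.2 hcb hbB)
  refine ⟨{A, B, C}, toFinite _, ?_, Or.inr ⟨a, ⟨ha, hak, fun h => hkA ((h A (by simp)).1 haA)⟩,
    b, ⟨hx.trans hb.symm, hbk, fun h => hkB ((h B (by simp)).1 hbB)⟩,
    c, ⟨hx.trans hc.symm, hck, fun h => hkC ((h C (by simp)).1 hcC)⟩,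
    fun h => hbA ((h A (by simp)).1 haA), fun h => hcA ((h A (by simp)).1 haA),
    fun h => hcB ((h B (by simp)).1 hbB)⟩⟩
  rintro _ (rfl | rfl | rfl) <;> assumption

theorem exists_right_pieces (h : IsAdmissible 𝒟 η) {x k k' : X} (hk : Sim k k')
    (hd : η ≤ dist k k') (hx : Indist 𝒟 x k) : ∃ F : Set (Set X), F.Finite ∧ (∀ A ∈ F, IsCut A) ∧
      ((∀ y, Indist 𝒟 x y → k < y → Sim y k) ∨
        HasThreePieces F {y | Indist 𝒟 x y ∧ k < y ∧ ¬ Indist F y k}) := by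
  by_cases hno : ∀ y, Indist 𝒟 x y → k < y → Sim y k
  · exact ⟨∅, finite_empty, by simp, Or.inl hno⟩
  push Not at hno
  obtain ⟨a, ha, hak, has⟩ := hno
  obtain ⟨A, hA, hkA, haA⟩ := Sim.exists_cut (fun h => has h.symm) hak.le
  obtain ⟨b, hb, hbk, hbA, hbs⟩ := h.exists_right hk hd (ha.symm.trans hx) hA haA hkA
  obtain ⟨B, hB, hkB, hbB⟩ := Sim.exists_cut (fun h => hbs h.symm) hbk.le
  obtain ⟨c, hc, hck, hcB, hcs⟩ := h.exists_right hk hd hb hB hbB hkB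
  obtain ⟨C, hC, hkC, hcC⟩ := Sim.exists_cut (fun h => hcs h.symm) hck.le
  have hcA : c ∈ A := by
    rcases le_total b c with hbc | hcb
    · exact absurd (hB.2 hbc hcB) hbB
    · exact hA.2 hcb hbA
  refine ⟨{A, B, C}, toFinite _, ?_, Or.inr ⟨a, ⟨ha, hak, fun h => haA ((h A (by simp)).2 hkA)⟩,
    b, ⟨hx.trans hb.symm, hbk, fun h => hbB ((h B (by simp)).2 hkB)⟩,
    c, ⟨hx.trans hc.symm, hck, fun h => hcC ((h C (by simp)).2 hkC)⟩,
    fun h => haA ((h A (by simp)).2 hbA), fun h => haA ((h A (by simp)).2 hcA),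
    fun h => hbB ((h B (by simp)).2 hcB)⟩⟩
  rintro _ (rfl | rfl | rfl) <;> assumption

theorem exists_subdivides (h : IsAdmissible 𝒟 η) :
    ∃ 𝒟', 𝒟 ⊆ 𝒟' ∧ IsCutFamily 𝒟' ∧ ∀ x, Subdivides 𝒟 𝒟' η x := by
  obtain ⟨𝒟', hsub, h𝒟', h'⟩ := h.exists_refinement (fun x F => Subdivides 𝒟 F η x) (by
    intro x
    rcases h.count x with hx | ⟨a, b, c, ha, hb, hc, hab, hbc, hsab, hsbc⟩
    · exact ⟨∅, finite_empty, by simp, Or.inl hx⟩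
    by_cases hbig : ∃ k k', Indist 𝒟 x k ∧ Sim k k' ∧ η ≤ dist k k'
    · obtain ⟨k, k', hk, hkk', hd⟩ := hbig
      obtain ⟨F, hF, hFc, hFl⟩ := h.exists_left_pieces hkk' hd hk
      obtain ⟨G, hG, hGc, hGr⟩ := h.exists_right_pieces hkk' hd hk
      refine ⟨F ∪ G, hF.union hG, fun A hA => hA.elim (hFc A) (hGc A),
        Or.inr (Or.inr ⟨k, k', hk, hkk', hd, hFl.imp_right ?_, hGr.imp_right ?_⟩)⟩
      · exact fun h => h.mono (fun y hy => ⟨hy.1, hy.2.1, fun h => hy.2.2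
          (h.mono subset_union_left)⟩) fun u _ v _ h => h.mono subset_union_left
      · exact fun h => h.mono (fun y hy => ⟨hy.1, hy.2.1, fun h => hy.2.2
          (h.mono subset_union_right)⟩) fun u _ v _ h => h.mono subset_union_right
    · push Not at hbig
      obtain ⟨A, hA, haA, hbA⟩ := Sim.exists_cut hsab hab.le
      obtain ⟨B, hB, hbB, hcB⟩ := Sim.exists_cut hsbc hbc.le
      refine ⟨{A, B}, toFinite _, ?_, Or.inr (Or.inl ⟨fun a b ha hab => hbig a b ha hab, a, ha, b,
        hb, c, hc, fun h => hbA ((h A (by simp)).1 haA), fun h => hcB ((h B (by simp)).1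
          (hB.2 hab.le hbB)), fun h => hcB ((h B (by simp)).1 hbB)⟩)⟩
      rintro _ (rfl | rfl) <;> assumption)
  refine ⟨𝒟', hsub, h𝒟', fun x => ?_⟩
  obtain ⟨x₀, F, hx, hF, hF'⟩ := h' x
  exact hF.mono hx fun u v hu hv => (hF' u v hu hv).1

variable [IsConvexMetric X]

/-- Fineness, uniqueness of big quasi-components, removed ends and subdivision all survive further
cutting. The count of quasi-components does not, so `exists_split` is applied last. -/
theorem exists_finer (h : IsAdmissible 𝒟 η) {η' : ℝ} (hη' : 0 < η') :
    ∃ 𝒟', 𝒟 ⊆ 𝒟' ∧ IsAdmissible 𝒟' η' ∧ IsFine 𝒟' η' ∧ ∀ x, Subdivides 𝒟 𝒟' η x := by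
  obtain ⟨ℰ, hℰ, hfine, hbig⟩ := exists_isFine (X := X) hη'
  obtain ⟨ℰ', hsub, hℰ', hends⟩ := hℰ.exists_ends hbig
  obtain ⟨𝒬, hsub', h𝒬, hpieces⟩ := h.exists_subdivides
  obtain ⟨𝒟', hsub'', h𝒟', hcount⟩ := (hℰ'.union h𝒬).exists_split
  have h1 : ℰ' ⊆ 𝒟' := subset_union_left.trans hsub''
  have h2 : 𝒬 ⊆ 𝒟' := subset_union_right.trans hsub''
  exact ⟨𝒟', hsub'.trans h2, { h𝒟' with
    big := hbig.mono (hsub.trans h1)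
    ends := fun a b x hab hd hx => hends a b x hab hd (hx.mono h1)
    count := hcount }, hfine.mono (hsub.trans h1), fun x => (hpieces x).mono (Indist.refl _ _)
      fun u v _ _ huv => huv.mono h2⟩

end IsAdmissible

/-! ### Tournaments between the pieces of a class. -/

/-- A tournament on the `𝒟'`-classes inside `V` which isolates these and respects the order across
big quasi-components. -/
structure IsArcOn (𝒟' : Set (Set X)) (η : ℝ) (V : Set X) (t : X → X → Prop) : Prop where
  congr : ∀ u ∈ V, ∀ v ∈ V, ∀ u' ∈ V, ∀ v' ∈ V, Indist 𝒟' u u' → Indist 𝒟' v v' → t u v → t u' v'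
  total : ∀ u ∈ V, ∀ v ∈ V, ¬ Indist 𝒟' u v → (t u v ↔ ¬ t v u)
  isolate : ∀ x ∈ V, ∃ F ⊆ V, F.Finite ∧ (∀ w ∈ F, ¬ Indist 𝒟' x w) ∧ ∀ y ∈ V, ¬ Indist 𝒟' x y →
    ∃ w ∈ F, ¬ Indist 𝒟' y w ∧ ((t w x ∧ t y w) ∨ (t x w ∧ t w y))
  lt : ∀ u ∈ V, ∀ v ∈ V, ∀ a b, u ≤ a → a ≤ b → b ≤ v → Sim a b → η ≤ dist a b →
    ¬ Indist 𝒟' u v → t u v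

/-- Without a big quasi-component any isolating tournament will do. Otherwise the pieces `L` to its
left come first, then the piece containing it, then the pieces `R` to its right, with isolating
tournaments inside `L` and `R`. -/
theorem Subdivides.exists_isArcOn {𝒟 𝒟' : Set (Set X)} {η : ℝ} {x : X} (h𝒟 : IsCutFamily 𝒟)
    (h𝒟' : IsCutFamily 𝒟') (hbig : BigUnique 𝒟 η) (h : Subdivides 𝒟 𝒟' η x) :
    ∃ t, IsArcOn 𝒟' η {y | Indist 𝒟 x y} t := by
  have hV : ∀ u v a, Indist 𝒟 x u → Indist 𝒟 x v → u ≤ a → a ≤ v → Indist 𝒟 x a :=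
    fun u v a hu hv h1 h2 => hu.trans ((hu.symm.trans hv).left h𝒟.lower h1 h2)
  rcases h with h | ⟨hsmall, h3⟩ | ⟨k, k', hk, hkk', hd, hl, hr⟩
  · have : ∀ u, Indist 𝒟 x u → ∀ v, Indist 𝒟 x v → Indist 𝒟' u v := fun u hu v hv =>
      h𝒟'.of_sim ((h u hu).symm.trans (h v hv))
    exact ⟨fun _ _ => True, ⟨fun _ _ _ _ _ _ _ _ _ _ _ => trivial,
      fun u hu v hv huv => absurd (this u hu v hv) huv,
      fun u hu => ⟨∅, by simp, by simp, by simp, fun v hv huv => absurd (this u hu v hv) huv⟩,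
      fun _ _ _ _ _ _ _ _ _ _ _ _ => trivial⟩⟩
  · obtain ⟨t, h1, h2, h3, -⟩ := exists_tournament_on (Or.inr h3)
    refine ⟨t, h1, h2, h3, fun u hu v hv a b hua hab hbv hsim hd => ?_⟩
    exact absurd hd (hsmall a b (hV u v a hu hv hua (hab.trans hbv)) hsim).not_ge
  · let V : Set X := {y | Indist 𝒟 x y}
    let L : Set X := {y | Indist 𝒟 x y ∧ y < k ∧ ¬ Indist 𝒟' y k}
    let R : Set X := {y | Indist 𝒟 x y ∧ k < y ∧ ¬ Indist 𝒟' y k}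
    obtain ⟨s, hs1, hs2, hs3, D, hDL, hDfin, hD⟩ := exists_tournament_on (𝒟 := 𝒟') (V := L)
      (hl.imp_left fun h => eq_empty_of_forall_notMem fun y hy =>
        hy.2.2 (h𝒟'.of_sim (h y hy.1 hy.2.1)))
    obtain ⟨r, hr1, hr2, hr3, E, hER, hEfin, hE⟩ := exists_tournament_on (𝒟 := 𝒟') (V := R)
      (hr.imp_left fun h => eq_empty_of_forall_notMem fun y hy =>
        hy.2.2 (h𝒟'.of_sim (h y hy.1 hy.2.1)))
    have hL : ∀ u ∈ V, ∀ v ∈ V, Indist 𝒟' u v → u ∈ L → v ∈ L := fun u _ v hv huv hu =>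
      ⟨hv, Indist.lt_of_not h𝒟'.lower hu.2.2 hu.2.1 huv (Indist.refl _ _),
        fun h => hu.2.2 (huv.trans h)⟩
    have hR : ∀ u ∈ V, ∀ v ∈ V, Indist 𝒟' u v → u ∈ R → v ∈ R := fun u _ v hv huv hu =>
      ⟨hv, Indist.lt_of_not h𝒟'.lower (fun h => hu.2.2 h.symm) hu.2.1 (Indist.refl _ _) huv,
        fun h => hu.2.2 (huv.trans h)⟩
    have hLV : L ⊆ V := fun u hu => hu.1
    have hRV : R ⊆ V := fun u hu => hu.1
    have hLR : ∀ u ∈ L, u ∉ R := fun u hu hu' => hu.2.1.not_gt hu'.2.1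
    have hM : ∀ u ∈ V, u ∉ L → u ∉ R → Indist 𝒟' u k := by
      intro u hu huL huR
      by_contra hne
      rcases lt_trichotomy u k with h | rfl | h
      exacts [huL ⟨hu, h, hne⟩, hne (Indist.refl _ _), huR ⟨hu, h, hne⟩]
    -- The tournament `s` is reversed, so that every piece of `L` precedes a piece in the finite set
    -- `D`, just as every piece of `R` is preceded by one in `E`. These sets bound `L` and `R`
    -- towards the middle.
    let t : X → X → Prop := fun u v => (u ∈ L ∧ v ∉ L) ∨ (u ∉ R ∧ v ∈ R) ∨
      (u ∈ L ∧ v ∈ L ∧ s v u) ∨ (u ∈ R ∧ v ∈ R ∧ r u v)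
    have htLL : ∀ u ∈ L, ∀ v ∈ L, (t u v ↔ s v u) := by
      intro u hu v hv
      simp [t, hu, hv, hLR u hu, hLR v hv]
    have htRR : ∀ u ∈ R, ∀ v ∈ R, (t u v ↔ r u v) := by
      intro u hu v hv
      have hu' : u ∉ L := fun h => hLR u h hu
      simp [t, hu, hv, hu']
    refine ⟨t, ⟨?_, ?_, ?_, ?_⟩⟩
    · intro u hu v hv u' hu' v' hv' huu' hvv' ht
      have e1 : u ∈ L ↔ u' ∈ L := ⟨hL u hu u' hu' huu', hL u' hu' u hu huu'.symm⟩
      have e2 : v ∈ L ↔ v' ∈ L := ⟨hL v hv v' hv' hvv', hL v' hv' v hv hvv'.symm⟩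
      have e3 : u ∈ R ↔ u' ∈ R := ⟨hR u hu u' hu' huu', hR u' hu' u hu huu'.symm⟩
      have e4 : v ∈ R ↔ v' ∈ R := ⟨hR v hv v' hv' hvv', hR v' hv' v hv hvv'.symm⟩
      rcases ht with ht | ht | ⟨h1, h2, ht⟩ | ⟨h1, h2, ht⟩
      · exact Or.inl ⟨e1.1 ht.1, fun h => ht.2 (e2.2 h)⟩
      · exact Or.inr (Or.inl ⟨fun h => ht.1 (e3.2 h), e4.1 ht.2⟩)
      · exact Or.inr (Or.inr (Or.inl ⟨e1.1 h1, e2.1 h2,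
          hs1 v h2 u h1 v' (e2.1 h2) u' (e1.1 h1) hvv' huu' ht⟩))
      · exact Or.inr (Or.inr (Or.inr ⟨e3.1 h1, e4.1 h2,
          hr1 u h1 v h2 u' (e3.1 h1) v' (e4.1 h2) huu' hvv' ht⟩))
    · intro u hu v hv huv
      by_cases h1 : u ∈ L
      · by_cases h2 : v ∈ L
        · rw [htLL u h1 v h2, htLL v h2 u h1]
          exact hs2 v h2 u h1 fun h => huv h.symm
        · simp [t, h1, h2, hLR u h1]
      · by_cases h3 : u ∈ R
        · by_cases h4 : v ∈ R
          · rw [htRR u h3 v h4, htRR v h4 u h3]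
            exact hr2 u h3 v h4 huv
          · simp [t, h1, h3, h4]
        · by_cases h2 : v ∈ L
          · simp [t, h1, h2, hLR v h2]
          · by_cases h4 : v ∈ R
            · simp [t, h1, h2, h3, h4]
            · exact absurd ((hM u hu h1 h3).trans (hM v hv h2 h4).symm) huv
    · intro u hu
      by_cases h1 : u ∈ L
      · obtain ⟨F, hFL, hFfin, hFu, hF⟩ := hs3 u h1
        obtain ⟨w, hw, huw, hsw⟩ := hD u h1
        -- Inside `L` the set `F` isolates `u`; the additional `w ∈ D` follows `u` and precedes
        -- everything outside `L`.
        refine ⟨insert w F, insert_subset (hLV (hDL hw)) (hFL.trans hLV), hFfin.insert w, ?_, ?_⟩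
        · rintro z (rfl | hz)
          exacts [huw, hFu z hz]
        · intro y hy huy
          by_cases h2 : y ∈ L
          · obtain ⟨z, hz, hyz, h3⟩ := hF y h2 huy
            refine ⟨z, Or.inr hz, hyz, ?_⟩
            rw [htLL z (hFL hz) u h1, htLL y h2 z (hFL hz), htLL u h1 z (hFL hz),
              htLL z (hFL hz) y h2]
            exact h3.symm
          · exact ⟨w, Or.inl rfl, fun h => h2 (hL w (hLV (hDL hw)) y hy h.symm (hDL hw)),
              Or.inr ⟨(htLL u h1 w (hDL hw)).2 hsw, Or.inl ⟨hDL hw, h2⟩⟩⟩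
      by_cases h3 : u ∈ R
      · obtain ⟨F, hFR, hFfin, hFu, hF⟩ := hr3 u h3
        obtain ⟨w, hw, huw, hrw⟩ := hE u h3
        refine ⟨insert w F, insert_subset (hRV (hER hw)) (hFR.trans hRV), hFfin.insert w, ?_, ?_⟩
        · rintro z (rfl | hz)
          exacts [huw, hFu z hz]
        · intro y hy huy
          by_cases h2 : y ∈ R
          · obtain ⟨z, hz, hyz, h4⟩ := hF y h2 huy
            refine ⟨z, Or.inr hz, hyz, ?_⟩
            rwa [htRR z (hFR hz) u h3, htRR y h2 z (hFR hz), htRR u h3 z (hFR hz),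
              htRR z (hFR hz) y h2]
          · exact ⟨w, Or.inl rfl, fun h => h2 (hR w (hRV (hER hw)) y hy h.symm (hER hw)),
              Or.inl ⟨(htRR w (hER hw) u h3).2 hrw, Or.inr (Or.inl ⟨h2, hER hw⟩)⟩⟩
      have huk := hM u hu h1 h3
      refine ⟨D ∪ E, union_subset (hDL.trans hLV) (hER.trans hRV), hDfin.union hEfin, ?_, ?_⟩
      · rintro w (hw | hw) huw
        exacts [(hDL hw).2.2 (huw.symm.trans huk), (hER hw).2.2 (huw.symm.trans huk)]
      · intro y hy huy
        by_cases h2 : y ∈ L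
        · obtain ⟨w, hw, hyw, hsw⟩ := hD y h2
          exact ⟨w, Or.inl hw, hyw, Or.inl ⟨Or.inl ⟨hDL hw, h1⟩, (htLL y h2 w (hDL hw)).2 hsw⟩⟩
        · by_cases h4 : y ∈ R
          · obtain ⟨w, hw, hyw, hrw⟩ := hE y h4
            exact ⟨w, Or.inr hw, hyw, Or.inr ⟨Or.inr (Or.inl ⟨h3, hER hw⟩),
              (htRR w (hER hw) y h4).2 hrw⟩⟩
          · exact absurd (huk.trans (hM y hy h2 h4).symm) huy
    · intro u hu v hv a b hua hab hbv hsim hd' huv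
      -- By uniqueness, `a` and `b` lie in the big quasi-component of `k`. So `u` is not in `R` and
      -- `v` is not in `L`.
      have hak : Sim a k := hbig a b k k' hsim hkk'
        ((hV u v a hu hv hua (hab.trans hbv)).symm.trans hk) hd' hd
      have huR : u ∉ R := fun h => h.2.2
        ((h𝒟'.of_sim hak).symm.left h𝒟'.lower h.2.1.le hua).symm
      have hvL : v ∉ L := fun h => h.2.2
        ((h𝒟'.of_sim (hsim.symm.trans hak)).right h𝒟'.lower hbv h.2.1.le)
      by_cases h1 : u ∈ L
      · exact Or.inl ⟨h1, hvL⟩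
      · by_cases h4 : v ∈ R
        · exact Or.inr (Or.inl ⟨huR, h4⟩)
        · exact absurd ((hM u hu h1 huR).trans (hM v hv hvL h4).symm) huv

theorem IsAdmissible.exists_isArcOn {𝒟 𝒟' : Set (Set X)} {η : ℝ} (h𝒟 : IsAdmissible 𝒟 η)
    (h𝒟' : IsCutFamily 𝒟') (h : ∀ x, Subdivides 𝒟 𝒟' η x) :
    ∃ t, ∀ x, IsArcOn 𝒟' η {y | Indist 𝒟 x y} t := by
  choose T hT using fun x => (h x).exists_isArcOn h𝒟.toIsCutFamily h𝒟' h𝒟.big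
  let rep : X → X := fun x => (Quotient.mk (Indist.setoid 𝒟) x).out
  refine ⟨fun u v => T (rep u) u v, fun x => ?_⟩
  have hset : {y | Indist 𝒟 x y} = {y | Indist 𝒟 (rep x) y} := by
    have h1 : Indist 𝒟 (rep x) x := Quotient.mk_out (s := Indist.setoid 𝒟) x
    ext y
    exact ⟨h1.trans, h1.symm.trans⟩
  have hrep : ∀ u ∈ {y | Indist 𝒟 x y}, rep u = rep x := fun u hu => by
    have : Quotient.mk (Indist.setoid 𝒟) x = Quotient.mk (Indist.setoid 𝒟) u := Quotient.sound hu
    simp only [rep, this]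
  have hx := hT (rep x)
  rw [← hset] at hx
  refine ⟨fun u hu v hv u' hu' v' hv' => ?_, fun u hu v hv => ?_, fun u hu => ?_,
    fun u hu v hv => ?_⟩
  · rw [hrep u hu, hrep u' hu']
    exact hx.congr u hu v hv u' hu' v' hv'
  · rw [hrep u hu, hrep v hv]
    exact hx.total u hu v hv
  · obtain ⟨F, hFV, hF, hF1, hF2⟩ := hx.isolate u hu
    refine ⟨F, hFV, hF, hF1, fun y hy huy => ?_⟩
    obtain ⟨w, hw, h1, h2⟩ := hF2 y hy huy
    refine ⟨w, hw, h1, ?_⟩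
    rwa [hrep u hu, hrep y hy, hrep w (hFV hw)]
  · rw [hrep u hu]
    exact hx.lt u hu v hv

end

/-! ### The tower and its selection relation. -/

/-- The topology having the open rays of a relation as a subbase. -/
@[reducible]
def rayTopology {X : Type*} (r : X → X → Prop) : TopologicalSpace X :=
  TopologicalSpace.generateFrom {S : Set X | ∃ x : X, S = {y | r y x} ∨ S = {y | r x y}}

theorem setOf_lt_mem_nhds_rayTopology {X : Type*} {r : X → X → Prop} {x w : X} (h : r x w) :
    {y | r y w} ∈ @nhds X (rayTopology r) x :=
  @IsOpen.mem_nhds X (rayTopology r) _ _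
    (TopologicalSpace.isOpen_generateFrom_of_mem ⟨w, Or.inl rfl⟩) h

theorem setOf_gt_mem_nhds_rayTopology {X : Type*} {r : X → X → Prop} {x w : X} (h : r w x) :
    {y | r w y} ∈ @nhds X (rayTopology r) x :=
  @IsOpen.mem_nhds X (rayTopology r) _ _
    (TopologicalSpace.isOpen_generateFrom_of_mem ⟨w, Or.inr rfl⟩) h

/-- A sequence of finer and finer cut families with tournaments between the pieces into which each
class is cut in the next step. -/
structure CutTower (X : Type*) [LinearOrder X] [MetricSpace X] where
  family : ℕ → Set (Set X)
  arc : ℕ → X → X → Prop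
  scale : ℕ → ℝ
  isCutFamily : ∀ n, IsCutFamily (family n)
  zero : ∀ x y, Indist (family 0) x y
  mono : ∀ n, family n ⊆ family (n + 1)
  isFine : ∀ n, IsFine (family (n + 1)) (scale (n + 1))
  isArcOn : ∀ n x, IsArcOn (family (n + 1)) (scale n) {y | Indist (family n) x y} (arc n)
  scale_lt : ∀ ε > 0, ∃ n, ∀ m, n ≤ m → scale m < ε

section

variable {X : Type*} [LinearOrder X] [MetricSpace X]

theorem exists_cutTower [IsConvexMetric X] (hd : ∀ x y : X, dist x y ≤ 1) {a b c : X} (hab : a < b)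
    (hbc : b < c) (hab' : ¬ Sim a b) (hbc' : ¬ Sim b c) : Nonempty (CutTower X) := by
  -- Since `η 0 = 2` exceeds the diameter bound `1`, there is no big quasi-component at the start
  -- and the empty family is admissible.
  let η : ℕ → ℝ := fun n => 2 / (n + 1)
  have hη : ∀ n, 0 < η n := fun n => by positivity
  have step : ∀ n (𝒟 : {𝒟 : Set (Set X) // IsAdmissible 𝒟 (η n)}),
      ∃ 𝒟' : {𝒟 : Set (Set X) // IsAdmissible 𝒟 (η (n + 1))}, ∃ t, 𝒟.1 ⊆ 𝒟'.1 ∧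
        IsFine 𝒟'.1 (η (n + 1)) ∧ ∀ x, IsArcOn 𝒟'.1 (η n) {y | Indist 𝒟.1 x y} t := by
    rintro n ⟨𝒟, h𝒟⟩
    obtain ⟨𝒟', hsub, h𝒟', hfine, h⟩ := h𝒟.exists_finer (hη (n + 1))
    obtain ⟨t, ht⟩ := h𝒟.exists_isArcOn h𝒟'.toIsCutFamily h
    exact ⟨⟨𝒟', h𝒟'⟩, t, hsub, hfine, ht⟩
  choose next t hsub hfine harc using step
  have hbase : IsAdmissible (∅ : Set (Set X)) (η 0) := by
    have hη0 : η 0 = 2 := by norm_num [η]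
    have hno : ∀ x y : X, ¬ η 0 ≤ dist x y := fun x y h => by linarith [hd x y]
    exact { isCut := by simp
            eventually := by simp [Indist]
            big := fun a b _ _ _ _ _ h => absurd h (hno a b)
            ends := fun a b _ _ h => absurd h (hno a b)
            count := fun x => Or.inr ⟨a, b, c, by simp [Indist], by simp [Indist],
              by simp [Indist], hab, hbc, hab', hbc'⟩ }
  let D : (n : ℕ) → {𝒟 : Set (Set X) // IsAdmissible 𝒟 (η n)} := fun n =>
    Nat.rec ⟨∅, hbase⟩ (fun n 𝒟 => next n 𝒟) n
  refine ⟨⟨fun n => (D n).1, fun n => t n (D n), η, fun n => (D n).2.toIsCutFamily, ?_,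
    fun n => hsub n (D n), fun n => hfine n (D n), fun n => harc n (D n), ?_⟩⟩
  · exact fun x y A hA => absurd hA (notMem_empty A)
  · intro ε hε
    obtain ⟨n, hn⟩ := exists_nat_gt (2 / ε)
    refine ⟨n, fun m hm => ?_⟩
    have : (n : ℝ) ≤ m := by exact_mod_cast hm
    rw [div_lt_iff₀ hε] at hn
    simp only [η]
    rw [div_lt_iff₀ (by positivity)]
    nlinarith

namespace CutTower

variable (T : CutTower X) {x y : X}

/-- Compare two points by the tournament on the pieces which first separate them, or else by the
linear order. -/
def lt (x y : X) : Prop :=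
  (∃ n, Indist (T.family n) x y ∧ ¬ Indist (T.family (n + 1)) x y ∧ T.arc n x y) ∨
    ((∀ n, Indist (T.family n) x y) ∧ x < y)

theorem indist_of_le {m n : ℕ} (hmn : m ≤ n) (h : Indist (T.family n) x y) :
    Indist (T.family m) x y :=
  h.mono (monotone_nat_of_le_succ T.mono hmn)

theorem indist_or_exists (x y : X) : (∀ n, Indist (T.family n) x y) ∨
    ∃ n, Indist (T.family n) x y ∧ ¬ Indist (T.family (n + 1)) x y := by
  by_contra! h
  obtain ⟨⟨n, hn⟩, h⟩ := h
  refine hn ?_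
  clear hn
  induction n with
  | zero => exact T.zero x y
  | succ n ih => exact h n ih

theorem lt_iff_arc {n : ℕ} (h : Indist (T.family n) x y) (h' : ¬ Indist (T.family (n + 1)) x y) :
    T.lt x y ↔ T.arc n x y := by
  constructor
  · rintro (⟨m, h1, h2, h3⟩ | ⟨h1, -⟩)
    · obtain rfl : m = n := by
        rcases lt_trichotomy m n with hlt | heq | hlt
        · exact absurd (T.indist_of_le hlt h) h2
        · exact heq
        · exact absurd (T.indist_of_le hlt h1) h'
      exact h3
    · exact absurd (h1 _) h'
  · exact fun h3 => Or.inl ⟨n, h, h', h3⟩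

theorem lt_iff_lt (h : ∀ n, Indist (T.family n) x y) : T.lt x y ↔ x < y := by
  constructor
  · rintro (⟨m, -, h2, -⟩ | ⟨-, h⟩)
    exacts [absurd (h _) h2, h]
  · exact fun h1 => Or.inr ⟨h, h1⟩

theorem lt_iff_not_lt (hxy : x ≠ y) : T.lt x y ↔ ¬ T.lt y x := by
  rcases T.indist_or_exists x y with h | ⟨n, h, h'⟩
  · rw [T.lt_iff_lt h, T.lt_iff_lt fun n => (h n).symm, not_lt]
    exact hxy.le_iff_lt.symm
  · rw [T.lt_iff_arc h h', T.lt_iff_arc h.symm fun h'' => h' h''.symm]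
    exact (T.isArcOn n x).total x (Indist.refl _ _) y h h'

theorem lt_irrefl (x : X) : ¬ T.lt x x := by
  rw [T.lt_iff_lt fun n => Indist.refl _ _]
  exact _root_.lt_irrefl x

/-- The points can only be separated at a level `m ≥ n`, where the quasi-component of `a` and `b`
counts as big and the tournament must respect the order across it. -/
theorem lt_of_sim {a b : X} {n : ℕ} (hxy : x < y) (h : Indist (T.family n) x y) (hxa : x ≤ a)
    (hab : a ≤ b) (hby : b ≤ y) (hsim : Sim a b) (hd : ∀ m, n ≤ m → T.scale m < dist a b) :
    T.lt x y := by
  rcases T.indist_or_exists x y with h1 | ⟨m, h1, h2⟩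
  · exact (T.lt_iff_lt h1).2 hxy
  · rw [T.lt_iff_arc h1 h2]
    have hnm : n ≤ m := by
      by_contra! hlt
      exact h2 (T.indist_of_le hlt h)
    exact (T.isArcOn m x).lt x (Indist.refl _ _) y h1 a b hxa hab hby hsim (hd m hnm).le h2

theorem exists_isFine {ε : ℝ} (hε : 0 < ε) : ∃ n, ∀ z, Indist (T.family n) x z →
    ∃ s t, Sim s t ∧ dist x s < ε ∧ dist z t < ε := by
  obtain ⟨n, hn⟩ := T.scale_lt ε hε
  refine ⟨n + 1, fun z hz => ?_⟩
  obtain ⟨s, t, hst, h1, h2⟩ := T.isFine n x z hz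
  have := hn (n + 1) (by omega)
  exact ⟨s, t, hst, h1.trans this, h2.trans this⟩

/-- A cut is constant near `x` and near `y`, and fineness provides points this close to them in a
common quasi-component. -/
theorem sim_of_forall (h : ∀ n, Indist (T.family n) x y) : Sim x y := by
  intro A hA
  obtain ⟨ε, hε, h1⟩ := Metric.eventually_nhds_iff.1 (hA.eventually x)
  obtain ⟨ε', hε', h2⟩ := Metric.eventually_nhds_iff.1 (hA.eventually y)
  obtain ⟨n, hn⟩ := T.exists_isFine (x := x) (lt_min hε hε')
  obtain ⟨s, t, hst, h3, h4⟩ := hn y (h n)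
  rw [dist_comm] at h3 h4
  exact (h1 (h3.trans_le (min_le_left _ _))).trans
    ((hst A hA).trans (h2 (h4.trans_le (min_le_right _ _))).symm)

/-- A comparison made by a tournament is constant on a product of open classes. For `x < y` never
separated, points moved by less than a third of `dist x y` still enclose a part of the
quasi-component longer than a third, so `lt_of_sim` applies at small scales. -/
theorem eventually_lt [IsConvexMetric X] (h : T.lt x y) :
    ∀ᶠ p in 𝓝 x ×ˢ 𝓝 y, T.lt p.1 p.2 := by
  rcases T.indist_or_exists x y with h1 | ⟨n, h1, h2⟩
  · rw [T.lt_iff_lt h1] at h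
    have hd : 0 < dist x y := dist_pos.2 h.ne
    obtain ⟨n, hn⟩ := T.scale_lt (dist x y / 3) (by positivity)
    have hx : ∀ᶠ u in 𝓝 x, Indist (T.family n) x u ∧ u < y ∧ dist u x < dist x y / 3 :=
      ((T.isCutFamily n).eventually x).and ((eventually_lt_nhds h).and
        (Metric.ball_mem_nhds x (by positivity)))
    have hy : ∀ᶠ v in 𝓝 y, Indist (T.family n) y v ∧ x < v ∧ dist v y < dist x y / 3 :=
      ((T.isCutFamily n).eventually y).and ((eventually_gt_nhds h).and
        (Metric.ball_mem_nhds y (by positivity)))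
    have hxy : ∀ᶠ p in 𝓝 x ×ˢ 𝓝 y, p.1 < p.2 := by
      rw [← nhds_prod_eq]
      exact continuous_fst.continuousAt.eventually_lt continuous_snd.continuousAt h
    filter_upwards [hx.prod_mk hy, hxy]
    rintro ⟨u, v⟩ ⟨⟨hu1, hu2, hu3⟩, hv1, hv2, hv3⟩ (huv : u < v)
    have hsim := T.sim_of_forall h1
    have hle : max x u ≤ min v y := max_le (le_min hv2.le h.le) (le_min huv.le hu2.le)
    have hdx : dist x (max x u) < dist x y / 3 := by
      rcases le_total x u with h | h
      · rwa [max_eq_right h, dist_comm]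
      · rw [max_eq_left h, dist_self]; positivity
    have hdy : dist (min v y) y < dist x y / 3 := by
      rcases le_total v y with h | h
      · rwa [min_eq_left h]
      · rw [min_eq_right h, dist_self]; positivity
    refine T.lt_of_sim huv (hu1.symm.trans ((h1 n).trans hv1)) (le_max_right x u) hle
      (min_le_left v y) ?_ fun m hm => (hn m hm).trans ?_
    · exact Sim.left (Sim.right hsim (le_max_left _ _) (hle.trans (min_le_right _ _))) hle
        (min_le_right _ _)
    · have := dist_triangle4 x (max x u) (min v y) y
      linarith
  · rw [T.lt_iff_arc h1 h2] at h
    filter_upwards [((T.isCutFamily (n + 1)).eventually x).prod_mk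
      ((T.isCutFamily (n + 1)).eventually y)]
    rintro ⟨u, v⟩ ⟨hu : Indist _ x u, hv : Indist _ y v⟩
    have hu' := T.indist_of_le n.le_succ hu
    have hv' := T.indist_of_le n.le_succ hv
    have h3 : Indist (T.family n) u v := hu'.symm.trans (h1.trans hv')
    have h4 : ¬ Indist (T.family (n + 1)) u v := fun h' => h2 (hu.trans (h'.trans hv.symm))
    change T.lt u v
    rw [T.lt_iff_arc h3 h4]
    exact (T.isArcOn n x).congr x (Indist.refl _ _) y h1 u hu' v (h1.trans hv') hu hv h

/-- Finitely many pieces isolate the piece of `x` within its class of level `n`. Rays ending at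
points of those pieces therefore cut out the class of level `n + 1`. -/
theorem family_mem_nhds (n : ℕ) (x : X) :
    {y | Indist (T.family n) x y} ∈ @nhds X (rayTopology T.lt) x := by
  induction n with
  | zero =>
    convert Filter.univ_mem
    exact eq_univ_of_forall fun y => T.zero x y
  | succ n ih =>
    obtain ⟨F, hFV, hFfin, hFx, hF⟩ := (T.isArcOn n x).isolate x (Indist.refl _ _)
    have hrays : ∀ w ∈ F, {y | (T.lt x w → T.lt y w) ∧ (T.lt w x → T.lt w y)} ∈
        @nhds X (rayTopology T.lt) x := by
      intro w _
      refine Filter.inter_mem (f := @nhds X (rayTopology T.lt) x) ?_ ?_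
      · by_cases h : T.lt x w
        · exact Filter.mem_of_superset (setOf_lt_mem_nhds_rayTopology h) fun y hy _ => hy
        · exact Filter.univ_mem' fun y h' => absurd h' h
      · by_cases h : T.lt w x
        · exact Filter.mem_of_superset (setOf_gt_mem_nhds_rayTopology h) fun y hy _ => hy
        · exact Filter.univ_mem' fun y h' => absurd h' h
    filter_upwards [ih, (Filter.biInter_mem hFfin).2 hrays] with y hy hyF
    by_contra hne
    obtain ⟨w, hw, hyw, h⟩ := hF y hy hne
    have h1 := mem_iInter₂.1 hyF w hw
    have hxw : Indist (T.family n) x w := hFV hw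
    have hxw' : ¬ Indist (T.family (n + 1)) x w := hFx w hw
    have hyw1 : Indist (T.family n) y w := hy.symm.trans hxw
    have key := T.lt_iff_not_lt (x := y) (y := w) (by rintro rfl; exact hyw (Indist.refl _ _))
    rcases h with ⟨h2, h3⟩ | ⟨h2, h3⟩
    · rw [← T.lt_iff_arc hxw.symm fun h => hxw' h.symm] at h2
      rw [← T.lt_iff_arc hyw1 hyw] at h3
      exact key.1 h3 (h1.2 h2)
    · rw [← T.lt_iff_arc hxw hxw'] at h2
      rw [← T.lt_iff_arc hyw1.symm fun h => hyw h.symm] at h3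
      exact key.1 (h1.1 h2) h3

variable [IsConvexMetric X]

/-- If the quasi-component of `x` extends to the left of `x`, a ray from one of its points, within a
small class, bounds the left side. If it starts at `x`, fineness alone suffices. -/
theorem left_mem_nhds {ρ : ℝ} (hρ : 0 < ρ) (x : X) :
    {y | y < x → dist y x < ρ} ∈ @nhds X (rayTopology T.lt) x := by
  have hconv : ∀ z y, z ≤ y → y ≤ x → dist z x < ρ → dist y x < ρ := fun z y h1 h2 h3 =>
    (dist_le_dist_of_le h1 h2 le_rfl).trans_lt h3
  by_cases hex : ∃ y < x, Sim y x
  · -- `x` is a limit of its quasi-component from the left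
    have hlim : ∀ ε > 0, ∀ z < x, ∃ y < x, z ≤ y ∧ Sim y x ∧ dist y x < ε := by
      intro ε hε z hzx
      obtain ⟨y, hyx, hsim⟩ := hex
      have h1 : ∃ w < x, dist w x < ε := by
        by_contra! h1
        have hcut : IsCut (Iio x) := by
          refine ⟨⟨?_, isOpen_Iio⟩, isLowerSet_Iio x⟩
          rw [← isOpen_compl_iff, compl_Iio, Metric.isOpen_iff]
          intro w hw
          rcases eq_or_lt_of_le (mem_Ici.1 hw) with rfl | hw
          · exact ⟨ε, hε, fun u hu => not_lt.1 fun hux => (h1 u hux).not_gt hu⟩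
          · obtain ⟨δ, hδ, h⟩ := Metric.isOpen_iff.1 (isOpen_Ioi (a := x)) w hw
            exact ⟨δ, hδ, h.trans Ioi_subset_Ici_self⟩
        exact _root_.lt_irrefl x ((hsim _ hcut).1 hyx)
      obtain ⟨w, hwx, hwd⟩ := h1
      have hmax : max (max y w) z < x := max_lt (max_lt hyx hwx) hzx
      refine ⟨max (max y w) z, hmax, le_max_right _ _, ?_, ?_⟩
      · exact Sim.right hsim ((le_max_left y w).trans (le_max_left _ _)) hmax.le
      · exact (dist_le_dist_of_le ((le_max_right y w).trans (le_max_left _ _)) hmax.le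
          le_rfl).trans_lt hwd
    obtain ⟨z, hzx, -⟩ := hex
    obtain ⟨y, hyx, -, hysim, hyd⟩ := hlim ρ hρ z hzx
    -- The interval `[y, y']` serves as a barrier: in a class of scale below its length, any `z < y`
    -- precedes `y'` and is excluded by the ray beyond `y'`.
    obtain ⟨y', hyx', hyy', hysim', hyd'⟩ := hlim (dist y x) (dist_pos.2 hyx.ne) y hyx
    have hlt : y < y' := lt_of_le_of_ne hyy' (by rintro rfl; exact _root_.lt_irrefl _ hyd')
    obtain ⟨n, hn⟩ := T.scale_lt (dist y y') (dist_pos.2 hlt.ne)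
    have hall : ∀ n, Indist (T.family n) y' x := fun n => (T.isCutFamily n).of_sim hysim'
    have hray : T.lt y' x := (T.lt_iff_lt hall).2 hyx'
    filter_upwards [T.family_mem_nhds n x, setOf_gt_mem_nhds_rayTopology hray] with z hz hyz hzx
    refine hconv y z ?_ hzx.le hyd
    by_contra! hzy
    refine (T.lt_iff_not_lt (hzy.trans hlt).ne).1 ?_ hyz
    exact T.lt_of_sim (hzy.trans hlt) (hz.symm.trans (hall n).symm) hzy.le hlt.le le_rfl
      (hysim.trans hysim'.symm) hn
  · push Not at hex
    -- a cut which leaves only a small gap to the left of `x`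
    obtain ⟨A, hA, hxA, hsmall⟩ : ∃ A, IsCut A ∧ x ∉ A ∧
        ∀ z ∉ A, z < x → dist z x < ρ / 2 := by
      by_cases h : ∃ y < x, dist y x < ρ / 2
      · obtain ⟨y, hyx, hyd⟩ := h
        obtain ⟨A, hA, hyA, hxA⟩ := Sim.exists_cut (hex y hyx) hyx.le
        refine ⟨A, hA, hxA, fun z hzA hzx => ?_⟩
        refine (dist_le_dist_of_le ?_ hzx.le le_rfl).trans_lt hyd
        by_contra! hzy
        exact hzA (hA.2 hzy.le hyA)
      · push Not at h
        refine ⟨Iio x, ⟨⟨?_, isOpen_Iio⟩, isLowerSet_Iio x⟩, by simp, fun z hz hzx => absurd hzx hz⟩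
        rw [← isOpen_compl_iff, compl_Iio, Metric.isOpen_iff]
        intro w hw
        rcases eq_or_lt_of_le (mem_Ici.1 hw) with rfl | hw
        · exact ⟨ρ / 2, by positivity, fun u hu => not_lt.1 fun hux => (h u hux).not_gt hu⟩
        · obtain ⟨δ, hδ, h⟩ := Metric.isOpen_iff.1 (isOpen_Ioi (a := x)) w hw
          exact ⟨δ, hδ, h.trans Ioi_subset_Ici_self⟩
    obtain ⟨ε, hε, hball⟩ := Metric.eventually_nhds_iff.1 (hA.eventually x)
    obtain ⟨n, hn⟩ := T.exists_isFine (x := x) (lt_min hε (half_pos hρ))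
    filter_upwards [T.family_mem_nhds n x] with y hy hyx
    obtain ⟨s, t, hst, hxs, hyt⟩ := hn y hy
    rw [dist_comm] at hxs
    -- As `s` is close to `x`, it avoids `A`, and `t` avoids `A` with it. So `t` lies less than `ρ /
    -- 2` to the left of `x`, or not to the left at all.
    have htA : t ∉ A := fun ht =>
      hxA ((hball (hxs.trans_le (min_le_left _ _))).2 ((hst A hA).2 ht))
    have hyt' : dist y t < ρ / 2 := hyt.trans_le (min_le_right _ _)
    rcases lt_or_ge t x with htx | hxt
    · have := hsmall t htA htx
      linarith [dist_triangle y t x]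
    · have := dist_le_dist_of_le le_rfl hyx.le hxt
      linarith

/-- The mirror image of `left_mem_nhds`. -/
theorem right_mem_nhds {ρ : ℝ} (hρ : 0 < ρ) (x : X) :
    {y | x < y → dist x y < ρ} ∈ @nhds X (rayTopology T.lt) x := by
  by_cases hex : ∃ y > x, Sim x y
  · -- `x` is a limit of its quasi-component from the right
    have hlim : ∀ ε > 0, ∀ z > x, ∃ y > x, y ≤ z ∧ Sim x y ∧ dist x y < ε := by
      intro ε hε z hxz
      obtain ⟨y, hxy, hsim⟩ := hex
      have h1 : ∃ w > x, dist x w < ε := by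
        by_contra! h1
        have hcut : IsCut (Iic x) := by
          refine ⟨⟨isClosed_Iic, ?_⟩, isLowerSet_Iic x⟩
          rw [Metric.isOpen_iff]
          intro w hw
          rcases eq_or_lt_of_le (mem_Iic.1 hw) with rfl | hw
          · refine ⟨ε, hε, fun u hu => not_lt.1 fun hux => (h1 u hux).not_gt ?_⟩
            rwa [dist_comm]
          · obtain ⟨δ, hδ, h⟩ := Metric.isOpen_iff.1 (isOpen_Iio (a := x)) w hw
            exact ⟨δ, hδ, h.trans Iio_subset_Iic_self⟩
        exact ((hsim _ hcut).1 le_rfl : y ≤ x).not_gt hxy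
      obtain ⟨w, hxw, hwd⟩ := h1
      have hmin : x < min (min y w) z := lt_min (lt_min hxy hxw) hxz
      refine ⟨min (min y w) z, hmin, min_le_right _ _, ?_, ?_⟩
      · exact Sim.left hsim hmin.le ((min_le_left _ _).trans (min_le_left y w))
      · exact (dist_le_dist_of_le le_rfl hmin.le
          ((min_le_left _ _).trans (min_le_right y w))).trans_lt hwd
    obtain ⟨z, hxz, -⟩ := hex
    obtain ⟨y, hxy, -, hysim, hyd⟩ := hlim ρ hρ z hxz
    obtain ⟨y', hxy', hyy', hysim', hyd'⟩ := hlim (dist x y) (dist_pos.2 hxy.ne) y hxy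
    have hlt : y' < y := lt_of_le_of_ne hyy' (by rintro rfl; exact _root_.lt_irrefl _ hyd')
    obtain ⟨n, hn⟩ := T.scale_lt (dist y' y) (dist_pos.2 hlt.ne)
    have hall : ∀ n, Indist (T.family n) x y' := fun n => (T.isCutFamily n).of_sim hysim'
    have hray : T.lt x y' := (T.lt_iff_lt hall).2 hxy'
    filter_upwards [T.family_mem_nhds n x, setOf_lt_mem_nhds_rayTopology hray] with z hz hyz hxz
    refine (dist_le_dist_of_le le_rfl hxz.le ?_).trans_lt hyd
    by_contra! hyz'
    refine (T.lt_iff_not_lt (hlt.trans hyz').ne).1 ?_ hyz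
    exact T.lt_of_sim (hlt.trans hyz') ((hall n).symm.trans hz) le_rfl hlt.le hyz'.le
      (hysim'.symm.trans hysim) hn
  · push Not at hex
    -- a cut which leaves only a small gap to the right of `x`
    obtain ⟨A, hA, hxA, hsmall⟩ : ∃ A, IsCut A ∧ x ∈ A ∧
        ∀ z ∈ A, x < z → dist x z < ρ / 2 := by
      by_cases h : ∃ y > x, dist x y < ρ / 2
      · obtain ⟨y, hxy, hyd⟩ := h
        obtain ⟨A, hA, hxA, hyA⟩ := Sim.exists_cut (hex y hxy) hxy.le
        refine ⟨A, hA, hxA, fun z hzA hxz => ?_⟩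
        refine (dist_le_dist_of_le le_rfl hxz.le ?_).trans_lt hyd
        by_contra! hyz
        exact hyA (hA.2 hyz.le hzA)
      · push Not at h
        refine ⟨Iic x, ⟨⟨isClosed_Iic, ?_⟩, isLowerSet_Iic x⟩, le_rfl,
          fun z hz hxz => absurd hxz (not_lt.2 hz)⟩
        rw [Metric.isOpen_iff]
        intro w hw
        rcases eq_or_lt_of_le (mem_Iic.1 hw) with rfl | hw
        · refine ⟨ρ / 2, by positivity, fun u hu => not_lt.1 fun hux => (h u hux).not_gt ?_⟩
          rwa [dist_comm]
        · obtain ⟨δ, hδ, h⟩ := Metric.isOpen_iff.1 (isOpen_Iio (a := x)) w hw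
          exact ⟨δ, hδ, h.trans Iio_subset_Iic_self⟩
    obtain ⟨ε, hε, hball⟩ := Metric.eventually_nhds_iff.1 (hA.eventually x)
    obtain ⟨n, hn⟩ := T.exists_isFine (x := x) (lt_min hε (half_pos hρ))
    filter_upwards [T.family_mem_nhds n x] with y hy hxy
    obtain ⟨s, t, hst, hxs, hyt⟩ := hn y hy
    rw [dist_comm] at hxs
    have htA : t ∈ A :=
      (hst A hA).1 ((hball (hxs.trans_le (min_le_left _ _))).1 hxA)
    have hyt' : dist y t < ρ / 2 := hyt.trans_le (min_le_right _ _)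
    rw [dist_comm] at hyt'
    rcases lt_or_ge x t with hxt | htx
    · have := hsmall t htA hxt
      linarith [dist_triangle x t y]
    · have := dist_le_dist_of_le htx hxy.le le_rfl
      linarith

theorem mem_nhds_rayTopology {U : Set X} {x : X} (hU : U ∈ 𝓝 x) :
    U ∈ @nhds X (rayTopology T.lt) x := by
  obtain ⟨ρ, hρ, h⟩ := Metric.mem_nhds_iff.1 hU
  filter_upwards [T.left_mem_nhds hρ x, T.right_mem_nhds hρ x] with y h1 h2
  rcases lt_trichotomy y x with hyx | rfl | hyx
  · exact h (h1 hyx)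
  · exact h (Metric.mem_ball_self hρ)
  · exact h (by rw [Metric.mem_ball, dist_comm]; exact h2 hyx)

end CutTower

end

/-! ### Convex metrics and connected components. -/

/-- A linearly ordered metrizable space with order-convex neighbourhood bases has a bounded
compatible convex metric. -/
theorem exists_isConvexMetric (X : Type*) [LinearOrder X] [t : TopologicalSpace X]
    [TopologicalSpace.MetrizableSpace X]
    (hconv : ∀ (x : X), ∀ U ∈ 𝓝 x, ∃ V ∈ 𝓝 x, V.OrdConnected ∧ V ⊆ U) :
    ∃ M : MetricSpace X, M.toUniformSpace.toTopologicalSpace = t ∧ IsConvexMetric X ∧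
      ∀ x y : X, dist x y ≤ 1 := by
  let d : X → X → ℝ := fun x y => min 1 ((TopologicalSpace.metrizableSpaceMetric X).dist x y)
  have hd_lt : ∀ (x : X), ∀ U ∈ 𝓝 x, ∃ ε > 0, ∀ y, d x y < ε → y ∈ U := by
    let _ := TopologicalSpace.metrizableSpaceMetric X
    intro x U hU
    obtain ⟨ε, hε, h⟩ := Metric.mem_nhds_iff.1 hU
    refine ⟨min 1 ε, by positivity, fun y hy => h ?_⟩
    rw [Metric.mem_ball, dist_comm]
    rcases min_lt_iff.1 hy with hy | hy
    · exact absurd (hy.trans_le (min_le_left 1 ε)) (by simp)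
    · exact hy.trans_le (min_le_right 1 ε)
  have hd_nhds : ∀ (x : X), ∀ ε > 0, {y | d x y < ε} ∈ 𝓝 x := by
    let _ := TopologicalSpace.metrizableSpaceMetric X
    intro x ε hε
    filter_upwards [Metric.ball_mem_nhds x hε] with y hy
    rw [Metric.mem_ball, dist_comm] at hy
    exact (min_le_right _ _).trans_lt hy
  have hd_self : ∀ x, d x x = 0 := fun x => by
    let _ := TopologicalSpace.metrizableSpaceMetric X
    simp only [d]
    rw [dist_self]
    simp
  have hd_comm : ∀ x y, d x y = d y x := fun x y => by
    let _ := TopologicalSpace.metrizableSpaceMetric X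
    simp only [d]
    rw [dist_comm]
  have hd_nonneg : ∀ x y, 0 ≤ d x y := fun x y => by
    let _ := TopologicalSpace.metrizableSpaceMetric X
    exact le_min zero_le_one dist_nonneg
  have hd_le : ∀ x y, d x y ≤ 1 := fun x y => min_le_left _ _
  have hd_tri : ∀ x y z, d x z ≤ d x y + d y z := fun x y z => by
    let _ := TopologicalSpace.metrizableSpaceMetric X
    have h1 := hd_nonneg x y
    have h2 := hd_nonneg y z
    have h3 := dist_triangle x y z
    simp only [d] at h1 h2 ⊢
    rcases min_choice 1 (dist x y) with h | h <;> rcases min_choice 1 (dist y z) with h' | h' <;>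
      rw [h] at h1 ⊢ <;> rw [h'] at h2 ⊢ <;>
      first
      | exact (min_le_left _ _).trans (by linarith)
      | exact (min_le_right _ _).trans (by linarith)
  have hd_eq : ∀ x y, d x y = 0 → x = y := fun x y h => by
    let _ := TopologicalSpace.metrizableSpaceMetric X
    rcases min_choice 1 (dist x y) with h' | h'
    · exact absurd (h'.symm.trans h) one_ne_zero
    · exact dist_eq_zero.1 (h'.symm.trans h)
  -- The diameter of the interval between `x` and `y` is monotone on intervals by construction;
  -- truncation of the metric at `1` keeps the supremum finite. Order-convex neighbourhoods make it
  -- compatible with the topology.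
  let D : X → X → ℝ := fun x y => ⨆ p : uIcc x y × uIcc x y, d p.1.1 p.2.1
  have hbdd : ∀ x y, BddAbove (range fun p : uIcc x y × uIcc x y => d p.1.1 p.2.1) := fun x y =>
    ⟨1, by rintro _ ⟨p, rfl⟩; exact hd_le _ _⟩
  have hle : ∀ x y u v, u ∈ uIcc x y → v ∈ uIcc x y → d u v ≤ D x y := fun x y u v hu hv =>
    le_ciSup (hbdd x y) (⟨u, hu⟩, ⟨v, hv⟩)
  have hsup : ∀ x y c, (∀ u ∈ uIcc x y, ∀ v ∈ uIcc x y, d u v ≤ c) → D x y ≤ c := by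
    intro x y c h
    have : Nonempty (uIcc x y) := ⟨⟨x, left_mem_uIcc⟩⟩
    exact ciSup_le fun p => h _ p.1.2 _ p.2.2
  have hD_nonneg : ∀ x y, 0 ≤ D x y := fun x y =>
    (hd_nonneg x y).trans (hle x y x y left_mem_uIcc right_mem_uIcc)
  have hD_self : ∀ x, D x x = 0 := fun x => by
    refine le_antisymm (hsup x x 0 fun u hu v hv => ?_) (hD_nonneg x x)
    rw [uIcc_self, mem_singleton_iff] at hu hv
    rw [hu, hv, hd_self]
  have hD_comm : ∀ x y, D x y = D y x := fun x y => by
    have : ∀ x y, D x y ≤ D y x := fun x y => hsup x y _ fun u hu v hv =>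
      hle y x u v (uIcc_comm x y ▸ hu) (uIcc_comm x y ▸ hv)
    exact (this x y).antisymm (this y x)
  have hD_tri : ∀ x y z, D x z ≤ D x y + D y z := by
    intro x y z
    refine hsup x z _ fun u hu v hv => ?_
    have h1 := hD_nonneg x y
    have h2 := hD_nonneg y z
    rcases uIcc_subset_uIcc_union_uIcc (b := y) hu with hu | hu <;>
    rcases uIcc_subset_uIcc_union_uIcc (b := y) hv with hv | hv
    · linarith [hle x y u v hu hv]
    · linarith [hle x y u y hu right_mem_uIcc, hle y z y v left_mem_uIcc hv, hd_tri u y v]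
    · linarith [hle x y y v right_mem_uIcc hv, hle y z u y hu left_mem_uIcc, hd_tri u y v]
    · linarith [hle y z u v hu hv]
  have hD_open : ∀ s : Set X, IsOpen s ↔ ∀ x ∈ s, ∃ ε > 0, ∀ y, D x y < ε → y ∈ s := by
    intro s
    rw [isOpen_iff_mem_nhds]
    refine forall₂_congr fun x _ => ⟨fun hs => ?_, ?_⟩
    · obtain ⟨ε, hε, h⟩ := hd_lt x s hs
      exact ⟨ε, hε, fun y hy => h y ((hle x y x y left_mem_uIcc right_mem_uIcc).trans_lt hy)⟩
    · rintro ⟨ε, hε, h⟩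
      obtain ⟨V, hV, hVc, hVε⟩ := hconv x _ (hd_nhds x (ε / 3) (by positivity))
      filter_upwards [hV] with y hy
      refine h y (lt_of_le_of_lt (hsup x y (2 * ε / 3) fun u hu v hv => ?_) (by linarith))
      have hsub := hVc.uIcc_subset (mem_of_mem_nhds hV) hy
      have h1 : d x u < ε / 3 := hVε (hsub hu)
      have h2 : d x v < ε / 3 := hVε (hsub hv)
      linarith [hd_tri u x v, hd_comm u x]
  refine ⟨MetricSpace.ofDistTopology D hD_self hD_comm hD_tri hD_open fun x y h => ?_, rfl, ?_, ?_⟩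
  · exact hd_eq x y (le_antisymm
      ((hle x y x y left_mem_uIcc right_mem_uIcc).trans h.le) (hd_nonneg x y))
  · let _ := MetricSpace.ofDistTopology D hD_self hD_comm hD_tri hD_open fun x y h =>
      hd_eq x y (le_antisymm
        ((hle x y x y left_mem_uIcc right_mem_uIcc).trans h.le) (hd_nonneg x y))
    refine ⟨fun {a b c e} hab hbc hce => hsup b c _ fun u hu v hv => hle a e u v ?_ ?_⟩ <;>
    rw [uIcc_of_le hbc] at hu hv <;> rw [uIcc_of_le (hab.trans (hbc.trans hce))]
    exacts [⟨hab.trans hu.1, hu.2.trans hce⟩, ⟨hab.trans hv.1, hv.2.trans hce⟩]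
  · exact fun x y => hsup x y 1 fun u _ v _ => hd_le u v

/-- The interval between two points of a quasi-component is connected: a separation of it would
yield a cut between its ends. -/
theorem Sim.connectedComponent_eq {X : Type*} [LinearOrder X] [MetricSpace X] [IsConvexMetric X]
    {x y : X} (h : Sim x y) : connectedComponent x = connectedComponent y := by
  wlog hxy : x ≤ y generalizing x y
  · exact (this h.symm (not_le.1 hxy).le).symm
  have key : ∀ u v : Set X, IsOpen u → IsOpen v → Icc x y ⊆ u ∪ v → x ∈ u →
      (Icc x y ∩ v).Nonempty → (Icc x y ∩ (u ∩ v)).Nonempty := by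
    intro u v hu hv huv hxu ⟨q, hq, hqv⟩
    by_contra hne
    have hdisj : ∀ z ∈ Icc x y, z ∈ u → z ∉ v := fun z hz hzu hzv => hne ⟨z, hz, hzu, hzv⟩
    -- This is the cut: it extends to where the interval first leaves `u`, and truncation at `y`
    -- makes conditions beyond `y` irrelevant.
    let A : Set X := {z | Icc x (min z y) ⊆ u}
    have hyA : y ∉ A := fun h => hdisj q hq (h (by simpa using hq)) hqv
    have hxA : x ∈ A := by simpa [A, hxy] using hxu
    have hlow : IsLowerSet A := fun a b hba ha =>
      (Icc_subset_Icc_right (min_le_min_right y hba)).trans ha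
    refine hyA ((h A ⟨⟨?_, ?_⟩, hlow⟩).1 hxA)
    · rw [← isOpen_compl_iff, isOpen_iff_mem_nhds]
      intro z hz
      obtain ⟨p, ⟨hxp, hp⟩, hpu⟩ := not_subset.1 hz
      rw [le_min_iff] at hp
      have hpA : ∀ w, p ≤ w → w ∈ Aᶜ := fun w hw hwA => hpu (hwA ⟨hxp, le_min hw hp.2⟩)
      rcases hp.1.lt_or_eq with hpz | rfl
      · filter_upwards [Ioi_mem_nhds hpz] with w hw using hpA w hw.le
      · have hpv : p ∈ v := (huv ⟨hxp, hp.2⟩).resolve_left hpu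
        have hxp' : x < p := lt_of_le_of_ne hxp (by rintro rfl; exact hpu hxu)
        filter_upwards [Ioi_mem_nhds hxp', hv.mem_nhds hpv] with w hxw hwv
        rcases le_total p w with hpw | hwp
        · exact hpA w hpw
        · have hw : w ∈ Icc x y := ⟨le_of_lt hxw, hwp.trans hp.2⟩
          exact fun hwA => hdisj w hw (hwA ⟨hw.1, le_min le_rfl hw.2⟩) hwv
    · rw [isOpen_iff_mem_nhds]
      intro z hz
      have hzy : z < y := not_le.1 fun h => hyA (hlow h hz)
      rcases lt_or_ge z x with hzx | hxz
      · filter_upwards [Iio_mem_nhds hzx] with w hw p hp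
        exact absurd (hp.1.trans (hp.2.trans (min_le_left _ _))) (not_le.2 hw)
      · have hzu : z ∈ u := hz ⟨hxz, le_min le_rfl hzy.le⟩
        obtain ⟨ε, hε, hball⟩ := Metric.isOpen_iff.1 hu z hzu
        filter_upwards [Metric.ball_mem_nhds z hε] with w hw p hp
        rcases le_total p z with hpz | hzp
        · exact hz ⟨hp.1, le_min hpz (hp.2.trans (min_le_right _ _))⟩
        · apply hball
          rw [Metric.mem_ball, dist_comm] at hw ⊢
          exact (dist_le_dist_of_le le_rfl hzp (hp.2.trans (min_le_left _ _))).trans_lt hw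
  have hpre : IsPreconnected (Icc x y) := by
    intro u v hu hv huv hneu hnev
    rcases huv (left_mem_Icc.2 hxy) with hx | hx
    · exact key u v hu hv huv hx hnev
    · rw [inter_comm u v]
      exact key v u hv hu (by rwa [union_comm]) hx hneu
  exact _root_.connectedComponent_eq (hpre.subset_connectedComponent (left_mem_Icc.2 hxy)
    (right_mem_Icc.2 hxy))

theorem exists_lt_lt_of_card_connectedComponents {X : Type*} [LinearOrder X] [MetricSpace X]
    [IsConvexMetric X] (h : 3 ≤ ENat.card (ConnectedComponents X)) :
    ∃ a b c : X, a < b ∧ b < c ∧ ¬ Sim a b ∧ ¬ Sim b c := by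
  rw [← encard_univ] at h
  obtain ⟨t, -, ht⟩ := exists_subset_encard_eq h
  obtain ⟨p, q, r, hpq, hpr, hqr, -⟩ := encard_eq_three.1 ht
  obtain ⟨a, rfl⟩ := ConnectedComponents.surjective_coe p
  obtain ⟨b, rfl⟩ := ConnectedComponents.surjective_coe q
  obtain ⟨c, rfl⟩ := ConnectedComponents.surjective_coe r
  have key : ∀ x y : X, (x : ConnectedComponents X) ≠ y → ¬ Sim x y := fun x y hxy hs =>
    hxy (ConnectedComponents.coe_eq_coe.2 hs.connectedComponent_eq)
  have hne : ∀ x y : X, (x : ConnectedComponents X) ≠ y → x ≠ y := fun x y hxy h => hxy (h ▸ rfl)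
  rcases lt_or_gt_of_ne (hne _ _ hpq) with h1 | h1 <;>
  rcases lt_or_gt_of_ne (hne _ _ hpr) with h2 | h2 <;>
  rcases lt_or_gt_of_ne (hne _ _ hqr) with h3 | h3
  · exact ⟨a, b, c, h1, h3, key _ _ hpq, key _ _ hqr⟩
  · exact ⟨a, c, b, h2, h3, key _ _ hpr, key _ _ hqr.symm⟩
  · exact absurd (h1.trans (h3.trans h2)) (lt_irrefl _)
  · exact ⟨c, a, b, h2, h1, key _ _ hpr.symm, key _ _ hpq⟩
  · exact ⟨b, a, c, h1, h2, key _ _ hpq.symm, key _ _ hpr⟩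
  · exact absurd (h2.trans (h3.trans h1)) (lt_irrefl _)
  · exact ⟨b, c, a, h3, h2, key _ _ hqr, key _ _ hpr.symm⟩
  · exact ⟨c, b, a, h3, h1, key _ _ hqr.symm, key _ _ hpq.symm⟩

/-! ### From the relation to a weak selection. -/

/-- An open total relation on a Hausdorff space comes from a continuous weak selection. -/
theorem exists_continuous_weakSelection {X : Type u} [TopologicalSpace X] [T2Space X]
    {r : X → X → Prop} (htotal : ∀ x y, x ≠ y → (r x y ↔ ¬ r y x)) (hirrefl : ∀ x, ¬ r x x)
    (hopen : ∀ x y, r x y → ∀ᶠ p in 𝓝 x ×ˢ 𝓝 y, r p.1 p.2) :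
    ∃ σ : WeakSelection X, Continuous σ.toFun ∧ σ.lt = r := by
  have hex : ∀ S : TwoSubsets X, ∃ x y, S.1 = {x, y} ∧ (x = y ∨ r x y) := by
    rintro ⟨S, h1, h2⟩
    rcases h2.lt_or_eq with h2 | h2
    · have : S.encard = 1 := le_antisymm (Order.le_of_lt_add_one (by rwa [one_add_one_eq_two])) h1
      obtain ⟨x, rfl⟩ := encard_eq_one.1 this
      exact ⟨x, x, by simp, Or.inl rfl⟩
    · obtain ⟨x, y, hxy, rfl⟩ := encard_eq_two.1 h2
      by_cases h : r x y
      · exact ⟨x, y, rfl, Or.inr h⟩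
      · exact ⟨y, x, pair_comm x y, Or.inr ((htotal y x hxy.symm).2 h)⟩
  choose m M hS hmM using hex
  let σ : WeakSelection X := ⟨m, fun S => by rw [hS S]; exact mem_insert _ _⟩
  have hmin : ∀ (S : TwoSubsets X), ∀ z ∈ S.1, z ≠ m S → r (m S) z := by
    intro S z hz hne
    rw [hS S] at hz
    rcases hz with rfl | rfl
    · exact absurd rfl hne
    · exact (hmM S).resolve_left fun h => hne h.symm
  refine ⟨σ, ?_, ?_⟩
  · rw [continuous_iff_continuousAt]
    intro S W hW
    rw [Filter.mem_map]
    obtain ⟨W', hWW, hW'o, hW'⟩ := mem_nhds_iff.1 hW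
    let _ := TopologicalSpace.vietoris X
    have hcont : Continuous (Subtype.val : TwoSubsets X → Set X) := continuous_induced_dom
    by_cases heq : m S = M S
    · have hopenS : IsOpen {T : TwoSubsets X | T.1 ⊆ W'} :=
        hW'o.powerset_vietoris.preimage hcont
      refine Filter.mem_of_superset (hopenS.mem_nhds ?_) fun T hT => hWW (hT (σ.mem T))
      change S.1 ⊆ W'
      rw [hS S, ← heq]
      simpa using hW'
    · have hr : r (m S) (M S) := (hmM S).resolve_left heq
      have hr' : ∀ᶠ p in 𝓝 (m S) ×ˢ 𝓝 (M S), r p.1 p.2 := hopen _ _ hr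
      obtain ⟨U₁, hU₁, V₁, hV₁, h₁⟩ := Filter.eventually_prod_iff.1 hr'
      obtain ⟨U₂, V₂, hU₂, hV₂, hmU, hMV, hdisj⟩ := t2_separation heq
      obtain ⟨U, hUs, hUo, hmU'⟩ := mem_nhds_iff.1
        (Filter.inter_mem hU₁ (Filter.inter_mem (hW'o.mem_nhds hW') (hU₂.mem_nhds hmU)))
      obtain ⟨V, hVs, hVo, hMV'⟩ := mem_nhds_iff.1 (Filter.inter_mem hV₁ (hV₂.mem_nhds hMV))
      have ho1 : IsOpen {T : TwoSubsets X | T.1 ⊆ U ∪ V} :=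
        (hUo.union hVo).powerset_vietoris.preimage hcont
      have ho2 : IsOpen {T : TwoSubsets X | (T.1 ∩ U).Nonempty} :=
        (TopologicalSpace.vietoris.isOpen_inter_nonempty_of_isOpen hUo).preimage hcont
      have hS1 : S.1 ⊆ U ∪ V := by
        rw [hS S]
        rintro z (rfl | rfl)
        exacts [Or.inl hmU', Or.inr hMV']
      have hS2 : (S.1 ∩ U).Nonempty := ⟨m S, σ.mem S, hmU'⟩
      refine Filter.mem_of_superset (Filter.inter_mem (ho1.mem_nhds hS1) (ho2.mem_nhds hS2)) ?_
      rintro T ⟨hT1, z, hzT, hzU⟩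
      -- If the selected point of `T` were in `V`, a point of `T` in `U` would precede it, against
      -- minimality.
      rcases hT1 (σ.mem T) with hT | hT
      · exact hWW (hUs hT).2.1
      · have h1 : r z (m T) := h₁ (hUs hzU).1 (hVs hT).1
        have hne : z ≠ m T := by
          rintro rfl
          exact hirrefl _ h1
        exact absurd (hmin T z hzT hne) ((htotal _ _ hne).1 h1)
  · ext x y
    have hx : x ∈ (TwoSubsets.pair x y).1 := mem_insert _ _
    have hy : y ∈ (TwoSubsets.pair x y).1 := mem_insert_of_mem _ rfl
    constructor
    · rintro ⟨h : m (TwoSubsets.pair x y) = x, hne⟩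
      have := hmin _ y hy (by rw [h]; exact hne.symm)
      rwa [h] at this
    · intro h
      have hne : x ≠ y := by
        rintro rfl
        exact hirrefl _ h
      refine ⟨?_, hne⟩
      by_contra hm
      rcases σ.mem (TwoSubsets.pair x y) with h' | h'
      · exact hm h'
      · have := hmin _ x hx fun h => hm h.symm
        change m (TwoSubsets.pair x y) = y at h'
        rw [h'] at this
        exact (htotal _ _ hne).1 h this

theorem CutTower.rayTopology_eq {X : Type*} [LinearOrder X] [M : MetricSpace X] [IsConvexMetric X]
    (T : CutTower X) : rayTopology T.lt = M.toUniformSpace.toTopologicalSpace := by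
  refine le_antisymm ?_ ?_
  · exact (le_iff_nhds _ _).2 fun x U hU => T.mem_nhds_rayTopology hU
  · refine le_generateFrom ?_
    rintro _ ⟨w, rfl | rfl⟩
    · refine isOpen_iff_mem_nhds.2 fun x hx => ?_
      have := T.eventually_lt hx
      exact this.curry.mono fun y hy => hy.self_of_nhds
    · refine isOpen_iff_mem_nhds.2 fun x hx => ?_
      have := T.eventually_lt hx
      exact (Filter.eventually_swap_iff.1 this).curry.mono fun y hy => hy.self_of_nhds

/-- The order pulled back along the embedding need not induce the topology. Order-convex
neighbourhood bases do pull back, and they are all that the convex metric requires. -/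
theorem IsSuborderable.exists_linearOrder {X : Type u} [TopologicalSpace X]
    (hX : IsSuborderable.{u, v} X) : ∃ _ : LinearOrder X,
      ∀ (x : X), ∀ U ∈ 𝓝 x, ∃ V ∈ 𝓝 x, V.OrdConnected ∧ V ⊆ U := by
  obtain ⟨Y, _, _, _, f, hf⟩ := hX
  let _ : LinearOrder X := LinearOrder.lift' f hf.injective
  refine ⟨inferInstance, fun x U hU => ?_⟩
  rw [hf.nhds_eq_comap, Filter.mem_comap] at hU
  obtain ⟨W, hW, hWU⟩ := hU
  refine ⟨f ⁻¹' ordConnectedComponent W (f x), ?_, ?_, ?_⟩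
  · rw [hf.nhds_eq_comap]
    exact Filter.preimage_mem_comap (ordConnectedComponent_mem_nhds.2 hW)
  · exact OrdConnected.preimage_mono inferInstance fun _ _ h => h
  · exact (preimage_mono ordConnectedComponent_subset).trans hWU

/-- A suborderable metrizable space with at least three components is generated by a continuous
weak selection. -/
theorem IsSuborderable.exists_selectionTopology_eq {X : Type u} [t : TopologicalSpace X]
    [TopologicalSpace.MetrizableSpace X] (hX : IsSuborderable.{u, v} X)
    (h : 3 ≤ ENat.card (ConnectedComponents X)) :
    ∃ σ : WeakSelection X, Continuous σ.toFun ∧ σ.selectionTopology = t := by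
  obtain ⟨_, hconv⟩ := hX.exists_linearOrder
  obtain ⟨M, rfl, _, hd⟩ := exists_isConvexMetric X hconv
  obtain ⟨a, b, c, hab, hbc, hab', hbc'⟩ := exists_lt_lt_of_card_connectedComponents h
  obtain ⟨T⟩ := exists_cutTower hd hab hbc hab' hbc'
  obtain ⟨σ, hσ, hlt⟩ := exists_continuous_weakSelection (r := T.lt)
    (fun x y hxy => T.lt_iff_not_lt hxy) T.lt_irrefl fun x y h => T.eventually_lt h
  refine ⟨σ, hσ, ?_⟩
  rw [← T.rayTopology_eq, ← hlt]

theorem cws_eq_one {X : Type u} [t : TopologicalSpace X] {σ : WeakSelection X}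
    (hσ : Continuous σ.toFun) (h : σ.selectionTopology = t) : cws X = 1 := by
  have hmem : (1 : Cardinal.{u}) ∈ {κ | ∃ A : Set (WeakSelection X), A.Nonempty ∧
      GeneratesTopology A ∧ Cardinal.mk A = κ} :=
    ⟨{σ}, singleton_nonempty σ, ⟨by simpa using hσ, by simp [h]⟩, Cardinal.mk_singleton σ⟩
  refine le_antisymm (csInf_le' hmem) (le_csInf ⟨1, hmem⟩ ?_)
  rintro _ ⟨A, hA, -, rfl⟩
  rw [Cardinal.one_le_iff_ne_zero, Cardinal.mk_ne_zero_iff]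
  exact hA.to_subtype

theorem theorem5p1 (X : Type u) [TopologicalSpace X] [TopologicalSpace.MetrizableSpace X]
    (hX : IsSuborderable.{u, v} X) :
    (Infinite (ConnectedComponents X) →
      cws X = 1 ∧
        ∃ σ : WeakSelection X, Continuous σ.toFun ∧ σ.selectionTopology = ‹TopologicalSpace X›) ∧
    (3 ≤ ENat.card (ConnectedComponents X) →
      cws X = 1 ∧
        ∃ σ : WeakSelection X, Continuous σ.toFun ∧
          σ.selectionTopology = ‹TopologicalSpace X›) := by
  have key : 3 ≤ ENat.card (ConnectedComponents X) → cws X = 1 ∧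
      ∃ σ : WeakSelection X, Continuous σ.toFun ∧
        σ.selectionTopology = ‹TopologicalSpace X› := fun h => by
    obtain ⟨σ, hσ, h⟩ := hX.exists_selectionTopology_eq h
    exact ⟨cws_eq_one hσ h, σ, hσ, h⟩
  refine ⟨fun _ => key ?_, key⟩
  rw [ENat.card_eq_top_of_infinite]
  exact le_top
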